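/- **Setting.** Let $\mathcal{O}\subset\mathbb{R}^2$ be a bounded domain, $T>0$, $\mu>0$, $\alpha,\beta\ge 0$. Let $\mathcal{V}$ be the set of divergence-free fields in $C_0^\infty(\mathcal{O};\mathbb{R}^2)$, let $\mathbb{H}$ and $\mathbb{V}$ be the closures of $\mathcal{V}$ in $L^2(\mathcal{O};\mathbb{R}^2)$ and in $H_0^1(\mathcal{O};\mathbb{R}^2)$, let $(\cdot,\cdot)$ be the inner product of $\mathbb{H}$ and $\langle\cdot,\cdot\rangle$ the duality between $\mathbb{V}'$ and $\mathbb{V}$. For $\mathbf{u},\mathbf{v},\mathbf{w}\in\mathbb{V}$ put $$\langle \mathrm{A}\mathbf{u},\mathbf{v}\rangle=\langle-\Delta\mathbf{u},\mathbf{v}\rangle=\int_{\mathcal{O}}\nabla\mathbf{u}:\nabla\mathbf{v}\,dx,\qquad \langle \mathrm{B}(\mathbf{u},\mathbf{v}),\mathbf{w}\rangle=\sum_{i,j=1}^2\int_{\mathcal{O}}u_i\,\partial_iv_j\,w_j\,dx,\qquad \mathrm{B}(\mathbf{u})=\mathrm{B}(\mathbf{u},\mathbf{u}),$$ $$\langle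 \mathcal{C}(\mathbf{u}),\mathbf{v}\rangle=\int_{\mathcal{O}}|\mathbf{u}|^2\,\mathbf{u}\cdot\mathbf{v}\,dx,\qquad \langle \mathcal{C}'(\mathbf{u})\mathbf{w},\mathbf{v}\rangle=\int_{\mathcal{O}}\big(|\mathbf{u}|^2\,\mathbf{w}\cdot\mathbf{v}+2(\mathbf{u}\cdot\mathbf{w})(\mathbf{u}\cdot\mathbf{v})\big)\,dx$$ (the case $r=3$ of $\mathcal{C}(\mathbf{u})=\mathcal{P}(|\mathbf{u}|^{r-1}\mathbf{u})$), and $\langle(\mathrm{B}'(\mathbf{u}))^*\mathbf{p},\mathbf{v}\rangle=\langle \mathrm{B}(\mathbf{u},\mathbf{v})+\mathrm{B}(\mathbf{v},\mathbf{u}),\mathbf{p}\rangle$. Let $\mathbf{f}\in L^2(0,T;\mathbb{V}')$, $\mathbf{u}_M\in L^2(0,T;\mathbb{H})$ and $\mathbf{u}_M^f\in\mathbb{H}$ be given. A weak solution with initial value $\mathrm{U}\in\mathbb{H}$ is a function $\mathbf{u}\in C([0,T];\mathbb{H})\cap L^2(0,T;\mathbb{V})$ with distributional derivative $\partial_t\mathbf{u}\in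 L^{4/3}(0,T;\mathbb{V}')$ such that $$\partial_t\mathbf{u}+\mu \mathrm{A}\mathbf{u}+\mathrm{B}(\mathbf{u})+\alpha\mathbf{u}+\beta\,\mathcal{C}(\mathbf{u})=\mathbf{f}\quad\text{in }\mathbb{V}',\text{ for a.e. }t\in[0,T],$$ $\lim_{t\downarrow0}(\mathbf{u}(t),\mathbf{v})=(\mathrm{U},\mathbf{v})$ for all $\mathbf{v}\in\mathbb{V}$, and, for all $t\in[0,T]$, $$\|\mathbf{u}(t)\|_{\mathbb{H}}^2+2\mu\int_0^t\|\nabla\mathbf{u}\|_{L^2}^2ds+2\alpha\int_0^t\|\mathbf{u}\|_{\mathbb{H}}^2ds+2\beta\int_0^t\|\mathbf{u}\|_{L^4}^4ds=\|\mathrm{U}\|_{\mathbb{H}}^2+2\int_0^t\langle\mathbf{f},\mathbf{u}\rangle ds.$$ The admissible class $\mathcal{A}_{\rm ad}$ is the set of all pairs $(\mathbf{u},\mathrm{U})$ with $\mathrm{U}\in\mathbb{H}$ such that $\mathbf{u}$ is the unique weak solution with initial value $\mathrm{U}$; its elements are called feasible pairs. Problem $(\mathrm{P}_0)$ is to minimize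 over $\mathcal{A}_{\rm ad}$ the functional $$\mathscr{J}(\mathbf{u},\mathrm{U})=\tfrac12\|\mathrm{U}\|_{\mathbb{H}}^2+\tfrac12\int_0^T\|\mathbf{u}-\mathbf{u}_M\|_{\mathbb{H}}^2dt+\tfrac12\int_0^T\|\nabla\times\mathbf{u}\|_{L^2}^2dt+\tfrac12\|\mathbf{u}(T)-\mathbf{u}_M^f\|_{\mathbb{H}}^2 .$$ **Theorem.** Let $(\mathbf{u}^*,\mathrm{U}^*)\in\mathcal{A}_{\rm ad}$, and let $\mathbf{p}\in C([0,T];\mathbb{H})\cap L^2(0,T;\mathbb{V})$, with distributional derivative $\partial_t\mathbf{p}\in L^{4/3}(0,T;\mathbb{V}')$, be the weak solution of the adjoint system $$-\partial_t\mathbf{p}+\mu \mathrm{A}\mathbf{p}+(\mathrm{B}'(\mathbf{u}^*))^*\mathbf{p}+\alpha\mathbf{p}+\beta\,\mathcal{C}'(\mathbf{u}^*)\mathbf{p}=(\mathbf{u}^*-\mathbf{u}_M)-\Delta\mathbf{u}^*\quad\text{in }\mathbb{V}',\text{ for a.e. }t\in[0,T],\qquad \mathbf{p}(T)=\mathbf{u}^*(T)-\mathbf{u}_M^f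 .$$ Suppose that $\mathrm{U}^*=-\mathbf{p}(0)$ and that, for every $(\mathbf{u},\mathrm{U})$ in $\{(\mathbf{z}-\mathbf{u}^*,\mathrm{W}-\mathrm{U}^*):(\mathbf{z},\mathrm{W})\in\mathcal{A}_{\rm ad}\}$, $$\frac12\int_0^T\big(\|\mathbf{u}\|_{\mathbb{H}}^2+\|\nabla\mathbf{u}\|_{L^2}^2\big)dt+\frac12\|\mathrm{U}\|_{\mathbb{H}}^2+\frac12\|\mathbf{u}(T)\|_{\mathbb{H}}^2-\int_0^T\langle \mathrm{B}(\mathbf{u},\mathbf{u}),\mathbf{p}\rangle dt-\beta\int_0^T\big\langle 2(\mathbf{u}^*\cdot\mathbf{u})\mathbf{u}+|\mathbf{u}|^2(\mathbf{u}+\mathbf{u}^*),\mathbf{p}\big\rangle dt\ \ge\ 0 .$$ Then $(\mathbf{u}^*,\mathrm{U}^*)$ is an optimal pair: $\mathscr{J}(\mathbf{u}^*,\mathrm{U}^*)\le\mathscr{J}(\mathbf{z},\mathrm{W})$ for all $(\mathbf{z},\mathrm{W})\in\mathcal{A}_{\rm ad}$. -/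

import Mathlib

open scoped ContDiff
open MeasureTheory

noncomputable section

namespace CBF

/-! ### Function spaces over a planar set `O` -/

/-- The Euclidean plane `ℝ²`. -/
abbrev Plane : Type := EuclideanSpace ℝ (Fin 2)

/-- `2 × 2` arrays with the Euclidean (Frobenius) norm; the gradient of a vector field has
entry `∂ᵢ uⱼ` at the position `(i, j)`. -/
abbrev Grad : Type := EuclideanSpace ℝ (Fin 2 × Fin 2)

/-- The classical partial derivative `∂ᵢ uⱼ` of a vector field on the plane. -/
def partialD (u : Plane → Plane) (i j : Fin 2) (x : Plane) : ℝ :=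
  fderiv ℝ u x (EuclideanSpace.single i (1 : ℝ)) j

/-- The classical gradient `(∂ᵢ uⱼ)ᵢⱼ`. -/
def gradField (u : Plane → Plane) (x : Plane) : Grad :=
  WithLp.toLp 2 (fun ij : Fin 2 × Fin 2 => partialD u ij.1 ij.2 x)

/-- The set `𝒱` of the divergence free, smooth vector fields with compact support in `O`. -/
structure IsSolenoidalTest (O : Set Plane) (u : Plane → Plane) : Prop where
  contDiff : ContDiff ℝ ∞ u
  hasCompactSupport : HasCompactSupport u
  tsupport_subset : tsupport u ⊆ O
  div_eq_zero : ∀ x, ∑ i, partialD u i i x = 0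

theorem partialD_add {u v : Plane → Plane} (hu : ContDiff ℝ ∞ u) (hv : ContDiff ℝ ∞ v)
    (i j : Fin 2) (x : Plane) :
    partialD (u + v) i j x = partialD u i j x + partialD v i j x := by
  have h1 : DifferentiableAt ℝ u x := (hu.differentiable (by simp)) x
  have h2 : DifferentiableAt ℝ v x := (hv.differentiable (by simp)) x
  simp [partialD, fderiv_add h1 h2]

theorem partialD_smul {u : Plane → Plane} (hu : ContDiff ℝ ∞ u) (c : ℝ)
    (i j : Fin 2) (x : Plane) :
    partialD (c • u) i j x = c * partialD u i j x := by
  have h1 : DifferentiableAt ℝ u x := (hu.differentiable (by simp)) x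
  simp [partialD, fderiv_const_smul h1 c]

theorem gradField_add {u v : Plane → Plane} (hu : ContDiff ℝ ∞ u) (hv : ContDiff ℝ ∞ v)
    (x : Plane) : gradField (u + v) x = gradField u x + gradField v x := by
  ext ij
  simp [gradField, partialD_add hu hv]

theorem gradField_smul {u : Plane → Plane} (hu : ContDiff ℝ ∞ u) (c : ℝ)
    (x : Plane) : gradField (c • u) x = c • gradField u x := by
  ext ij
  simp [gradField, partialD_smul hu]

theorem gradField_zero (x : Plane) : gradField 0 x = 0 := by
  ext ij
  simp [gradField, partialD]

namespace IsSolenoidalTest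

theorem zero (O : Set Plane) : IsSolenoidalTest O 0 where
  contDiff := contDiff_const
  hasCompactSupport := HasCompactSupport.zero
  tsupport_subset := by simp [tsupport]
  div_eq_zero x := by simp [partialD]

theorem add {O : Set Plane} {u v : Plane → Plane} (hu : IsSolenoidalTest O u)
    (hv : IsSolenoidalTest O v) : IsSolenoidalTest O (u + v) where
  contDiff := hu.contDiff.add hv.contDiff
  hasCompactSupport := hu.hasCompactSupport.add hv.hasCompactSupport
  tsupport_subset :=
    (tsupport_add u v).trans (Set.union_subset hu.tsupport_subset hv.tsupport_subset)
  div_eq_zero x := by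
    simp only [partialD_add hu.contDiff hv.contDiff, Finset.sum_add_distrib,
      hu.div_eq_zero, hv.div_eq_zero, add_zero]

theorem smul {O : Set Plane} {u : Plane → Plane} (hu : IsSolenoidalTest O u) (c : ℝ) :
    IsSolenoidalTest O (c • u) where
  contDiff := contDiff_const.smul hu.contDiff
  hasCompactSupport := hu.hasCompactSupport.smul_left (f := fun _ => c)
  tsupport_subset := (tsupport_smul_subset_right (fun _ => c) u).trans hu.tsupport_subset
  div_eq_zero x := by
    simp only [partialD_smul hu.contDiff, ← Finset.mul_sum, hu.div_eq_zero, mul_zero]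

end IsSolenoidalTest

/-- `L²(O; ℝ²)`. -/
abbrev L2Vec (O : Set Plane) : Type := Lp Plane 2 (volume.restrict O)

/-- `L²(O; ℝ²ˣ²)`. -/
abbrev L2Grad (O : Set Plane) : Type := Lp Grad 2 (volume.restrict O)

/-- The classes in `L²(O; ℝ²)` of the elements of `𝒱`. -/
def testL2 (O : Set Plane) : Submodule ℝ (L2Vec O) where
  carrier := {f | ∃ u, IsSolenoidalTest O u ∧ f =ᵐ[volume.restrict O] u}
  zero_mem' := ⟨0, IsSolenoidalTest.zero O, Lp.coeFn_zero _ _ _⟩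
  add_mem' := by
    rintro f g ⟨u, hu, hfu⟩ ⟨v, hv, hgv⟩
    exact ⟨u + v, hu.add hv, (Lp.coeFn_add f g).trans (hfu.add hgv)⟩
  smul_mem' := by
    rintro c f ⟨u, hu, hfu⟩
    exact ⟨c • u, hu.smul c, (Lp.coeFn_smul c f).trans (hfu.const_smul c)⟩

/-- The space `ℍ`: the closure of `𝒱` in `L²(O; ℝ²)`, with the `L²` inner product. -/
def H (O : Set Plane) : Submodule ℝ (L2Vec O) := (testL2 O).topologicalClosure

/-- The pairs `(u, ∇u)`, `u ∈ 𝒱`, in `L² × L²` with the Hilbert norm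
`(‖u‖² + ‖∇u‖²)^(1/2)`, which is the norm of `H¹`. -/
def testH1 (O : Set Plane) : Submodule ℝ (WithLp 2 (L2Vec O × L2Grad O)) where
  carrier := {w | ∃ u, IsSolenoidalTest O u ∧ w.fst =ᵐ[volume.restrict O] u ∧
    w.snd =ᵐ[volume.restrict O] gradField u}
  zero_mem' := ⟨0, IsSolenoidalTest.zero O, Lp.coeFn_zero _ _ _, by
    refine (Lp.coeFn_zero Grad 2 (volume.restrict O)).trans ?_
    exact Filter.Eventually.of_forall fun x => (gradField_zero x).symm⟩
  add_mem' := by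
    rintro f g ⟨u, hu, hfu, hfu'⟩ ⟨v, hv, hgv, hgv'⟩
    refine ⟨u + v, hu.add hv, (Lp.coeFn_add f.fst g.fst).trans (hfu.add hgv), ?_⟩
    refine (Lp.coeFn_add f.snd g.snd).trans ((hfu'.add hgv').trans ?_)
    exact Filter.Eventually.of_forall fun x => (gradField_add hu.contDiff hv.contDiff x).symm
  smul_mem' := by
    rintro c f ⟨u, hu, hfu, hfu'⟩
    refine ⟨c • u, hu.smul c, (Lp.coeFn_smul c f.fst).trans (hfu.const_smul c), ?_⟩
    refine (Lp.coeFn_smul c f.snd).trans ((hfu'.const_smul c).trans ?_)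
    exact Filter.Eventually.of_forall fun x => (gradField_smul hu.contDiff c x).symm

/-- The closure of the pairs `(u, ∇u)`, `u ∈ 𝒱`, in `L² × L²`. -/
def VSub (O : Set Plane) : Submodule ℝ (WithLp 2 (L2Vec O × L2Grad O)) :=
  (testH1 O).topologicalClosure

/-- The space `𝕍`: the closure of `𝒱` in `H¹₀(O; ℝ²)`. An element of `H¹₀` is represented by the
pair of its `L²` class and of its (weak) gradient, and the norm is that of `H¹`. -/
def V (O : Set Plane) : Type := VSub O

instance (O : Set Plane) : NormedAddCommGroup (V O) :=
  inferInstanceAs (NormedAddCommGroup (VSub O))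

instance (O : Set Plane) : InnerProductSpace ℝ (V O) :=
  inferInstanceAs (InnerProductSpace ℝ (VSub O))

instance (O : Set Plane) : CompleteSpace (V O) :=
  Submodule.topologicalClosure.completeSpace (testH1 O)

instance (O : Set Plane) : CompleteSpace (H O) :=
  Submodule.topologicalClosure.completeSpace (testL2 O)

/-- The dual space `𝕍'`, the space of the continuous linear functionals on `𝕍`. -/
def VDual (O : Set Plane) : Type := V O →L[ℝ] ℝ

instance (O : Set Plane) : NormedAddCommGroup (VDual O) :=
  inferInstanceAs (NormedAddCommGroup (V O →L[ℝ] ℝ))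

instance (O : Set Plane) : NormedSpace ℝ (VDual O) :=
  inferInstanceAs (NormedSpace ℝ (V O →L[ℝ] ℝ))

instance (O : Set Plane) : FunLike (VDual O) (V O) ℝ :=
  inferInstanceAs (FunLike (V O →L[ℝ] ℝ) (V O) ℝ)

instance (O : Set Plane) : ContinuousLinearMapClass (VDual O) ℝ (V O) ℝ :=
  inferInstanceAs (ContinuousLinearMapClass (V O →L[ℝ] ℝ) ℝ (V O) ℝ)

variable {O : Set Plane}

/-- The pair `(v, ∇v)` of an element of `𝕍`. -/
def V.pair (v : V O) : WithLp 2 (L2Vec O × L2Grad O) := Subtype.val (p := (· ∈ VSub O)) v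

/-- The `L²` class of an element of `𝕍`. -/
def V.val (v : V O) : L2Vec O := v.pair.fst

/-- The gradient of an element of `𝕍`. -/
def V.grad (v : V O) : L2Grad O := v.pair.snd

theorem V.val_mem (v : V O) : V.val v ∈ H O := by
  have hcont : Continuous
      (fun w : WithLp 2 (L2Vec O × L2Grad O) => w.fst) :=
    continuous_fst.comp (WithLp.prod_continuous_ofLp 2 _ _)
  have hv : v.pair ∈ closure (testH1 O : Set (WithLp 2 (L2Vec O × L2Grad O))) :=
    Subtype.property (p := (· ∈ VSub O)) v
  have key : v.pair.fst ∈ closure (testL2 O : Set (L2Vec O)) := by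
    refine map_mem_closure hcont hv ?_
    rintro w ⟨u, hu, h1, -⟩
    exact ⟨u, hu, h1⟩
  exact key

/-- The embedding `𝕍 ⊂ ℍ`. -/
def V.toH (v : V O) : H O := ⟨V.val v, V.val_mem v⟩

theorem V.toH_sub (v w : V O) : V.toH (v - w) = V.toH v - V.toH w := rfl

/-! ### The operators -/

/-- `⟨A u, v⟩ = ∫ ∇u : ∇v`, which is also `⟨-Δu, v⟩`. -/
def stokes (u v : V O) : ℝ := inner ℝ (V.grad u) (V.grad v)

/-- `b(u, v, w) = ∑ᵢⱼ ∫ uᵢ ∂ᵢvⱼ wⱼ = ⟨B(u, v), w⟩`. -/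
def trilinear (u v w : V O) : ℝ :=
  ∫ x in O, ∑ i, ∑ j, V.val u x i * V.grad v x (i, j) * V.val w x j

/-- `⟨𝒞(u), v⟩ = ∫ |u|² u · v`, the case `r = 3` of `𝒞(u) = 𝒫(|u|^(r-1) u)`. -/
def forch (u v : V O) : ℝ :=
  ∫ x in O, ‖V.val u x‖ ^ 2 * inner ℝ (V.val u x) (V.val v x)

/-- `⟨𝒞'(u) w, v⟩ = ∫ |u|² w · v + 2 ∫ (u · w) (u · v)`, for `r = 3`. -/
def forchDeriv (u w v : V O) : ℝ :=
  ∫ x in O, (‖V.val u x‖ ^ 2 * inner ℝ (V.val w x) (V.val v x) +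
    2 * (inner ℝ (V.val u x) (V.val w x) * inner ℝ (V.val u x) (V.val v x)))

/-- `⟨2 (u* · u) u + |u|² (u + u*), p⟩`. -/
def forchRemainder (us u p : V O) : ℝ :=
  ∫ x in O, inner ℝ ((2 * inner ℝ (V.val us x) (V.val u x)) • V.val u x +
    ‖V.val u x‖ ^ 2 • (V.val u x + V.val us x)) (V.val p x)

/-- `‖∇ × u‖²`, where `∇ × u = ∂₁u₂ - ∂₂u₁`. -/
def curlSq (u : V O) : ℝ :=
  ∫ x in O, (V.grad u x (0, 1) - V.grad u x (1, 0)) ^ 2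

/-! ### Paths and time derivatives -/

/-- Lebesgue measure on the time interval. -/
abbrev timeMeasure (T : ℝ) : Measure ℝ := volume.restrict (Set.Ioc 0 T)

/-- An element of `C([0,T]; ℍ) ∩ L²(0,T; 𝕍)`: `toH` is its continuous version with values in `ℍ`,
`toV` is its `𝕍`-valued version, and the two agree almost everywhere.
Values at times outside `[0,T]` play no role. -/
structure EnergyPath (O : Set Plane) (T : ℝ) where
  toH : ℝ → H O
  toV : ℝ → V O
  continuousOn : ContinuousOn toH (Set.Icc 0 T)
  memLp : MemLp toV 2 (timeMeasure T)
  compat : ∀ᵐ t ∂(timeMeasure T), V.toH (toV t) = toH t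

instance (T : ℝ) : Sub (EnergyPath O T) where
  sub u v :=
    { toH := fun t => u.toH t - v.toH t
      toV := fun t => u.toV t - v.toV t
      continuousOn := u.continuousOn.sub v.continuousOn
      memLp := u.memLp.sub v.memLp
      compat := by
        filter_upwards [u.compat, v.compat] with t h1 h2
        rw [V.toH_sub, h1, h2] }

/-- `g = ∂ₜu` with `g ∈ L^(4/3)(0,T; 𝕍')`: the time derivative of `u` in the sense of
`𝕍'`-valued distributions on `(0,T)`. -/
def IsTimeDerivative {T : ℝ} (u : EnergyPath O T) (g : ℝ → VDual O) : Prop :=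
  MemLp g (4 / 3) (timeMeasure T) ∧
  ∀ φ : ℝ → ℝ, ContDiff ℝ ∞ φ → HasCompactSupport φ → tsupport φ ⊆ Set.Ioo 0 T →
    ∀ v : V O, ∫ t in (0 : ℝ)..T, deriv φ t * inner ℝ (u.toH t) (V.toH v) =
      - ∫ t in (0 : ℝ)..T, φ t * g t v

/-! ### The state equation and the adjoint equation, `r = 3` -/

/-- `u ∈ C([0,T]; ℍ) ∩ L²(0,T; 𝕍)` is a weak solution of
`∂ₜu + μ A u + B(u) + α u + β 𝒞(u) = f` in `𝕍'`, `u(0) = U`, with the energy equality. -/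
structure IsWeakSolution {T : ℝ} (μ α β : ℝ) (f : ℝ → VDual O) (u : EnergyPath O T) (U : H O) :
    Prop where
  equation : ∃ g : ℝ → VDual O, IsTimeDerivative u g ∧
    ∀ᵐ t ∂(timeMeasure T), ∀ v : V O,
      g t v + μ * stokes (u.toV t) v + trilinear (u.toV t) (u.toV t) v +
        α * inner ℝ (u.toH t) (V.toH v) + β * forch (u.toV t) v = f t v
  initial : ∀ v : V O, Filter.Tendsto (fun t => (inner ℝ (u.toH t) (V.toH v) : ℝ))
    (nhdsWithin 0 (Set.Ioi 0)) (nhds (inner ℝ U (V.toH v)))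
  energy : ∀ t ∈ Set.Icc 0 T,
    ‖u.toH t‖ ^ 2 + 2 * μ * (∫ s in (0 : ℝ)..t, ‖V.grad (u.toV s)‖ ^ 2) +
        2 * α * (∫ s in (0 : ℝ)..t, ‖u.toH s‖ ^ 2) +
        2 * β * (∫ s in (0 : ℝ)..t, ∫ x in O, ‖V.val (u.toV s) x‖ ^ 4) =
      ‖U‖ ^ 2 + 2 * ∫ s in (0 : ℝ)..t, f s (u.toV s)

/-- The admissible class: the pairs `(u, U)`, `U ∈ ℍ`, such that `u` is the unique weak solution
of the state equation with initial value `U`. -/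
def admissibleClass (T μ α β : ℝ) (f : ℝ → VDual O) : Set (EnergyPath O T × H O) :=
  {w | IsWeakSolution μ α β f w.1 w.2 ∧
    ∀ z : EnergyPath O T, IsWeakSolution μ α β f z w.2 →
      ∀ t ∈ Set.Icc 0 T, z.toH t = w.1.toH t}

/-- The cost functional
`½‖U‖² + ½∫‖u - u_M‖² dt + ½∫‖∇ × u‖² dt + ½‖u(T) - u_M^f‖²`. -/
def cost {T : ℝ} (uM : ℝ → H O) (uMf : H O) (u : EnergyPath O T) (U : H O) : ℝ :=
  1 / 2 * ‖U‖ ^ 2 + 1 / 2 * (∫ t in (0 : ℝ)..T, ‖u.toH t - uM t‖ ^ 2) +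
    1 / 2 * (∫ t in (0 : ℝ)..T, curlSq (u.toV t)) + 1 / 2 * ‖u.toH T - uMf‖ ^ 2

/-- `(u, U)` is admissible and minimizes the cost functional over the admissible class. -/
def IsOptimalPair {T : ℝ} (μ α β : ℝ) (f : ℝ → VDual O) (uM : ℝ → H O) (uMf : H O)
    (u : EnergyPath O T) (U : H O) : Prop :=
  (u, U) ∈ admissibleClass T μ α β f ∧
    ∀ w ∈ admissibleClass T μ α β f, cost uM uMf u U ≤ cost uM uMf w.1 w.2

/-- `p ∈ C([0,T]; ℍ) ∩ L²(0,T; 𝕍)` is a weak solution of the adjoint system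
`-∂ₜp + μ A p + (B'(u))* p + α p + β 𝒞'(u) p = (u - u_M) - Δu` in `𝕍'`,
`p(T) = u(T) - u_M^f`, where `⟨(B'(u))* p, v⟩ = ⟨B(u, v) + B(v, u), p⟩`. -/
structure IsAdjointSolution {T : ℝ} (μ α β : ℝ) (uM : ℝ → H O) (uMf : H O)
    (u p : EnergyPath O T) : Prop where
  equation : ∃ g : ℝ → VDual O, IsTimeDerivative p g ∧
    ∀ᵐ t ∂(timeMeasure T), ∀ v : V O,
      - g t v + μ * stokes (p.toV t) v +
        (trilinear (u.toV t) v (p.toV t) + trilinear v (u.toV t) (p.toV t)) +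
        α * inner ℝ (p.toH t) (V.toH v) + β * forchDeriv (u.toV t) (p.toV t) v =
      inner ℝ (u.toH t - uM t) (V.toH v) + stokes (u.toV t) v
  terminal : p.toH T = u.toH T - uMf

/-- The differences of all admissible pairs with the pair `(u, U)`. -/
def feasibleDifferences (T μ α β : ℝ) (f : ℝ → VDual O) (u : EnergyPath O T) (U : H O) :
    Set (EnergyPath O T × H O) :=
  {d | ∃ w ∈ admissibleClass T μ α β f, d = (w.1 - u, w.2 - U)}

/-- The second order expression at the state `us` with adjoint state `p`, in the
direction `(u, U)`. -/
def secondOrderForm {T : ℝ} (β : ℝ) (us p u : EnergyPath O T) (U : H O) : ℝ :=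
  1 / 2 * (∫ t in (0 : ℝ)..T, (‖u.toH t‖ ^ 2 + ‖V.grad (u.toV t)‖ ^ 2)) +
    1 / 2 * ‖U‖ ^ 2 + 1 / 2 * ‖u.toH T‖ ^ 2 -
    (∫ t in (0 : ℝ)..T, trilinear (u.toV t) (u.toV t) (p.toV t)) -
    β * ∫ t in (0 : ℝ)..T, forchRemainder (us.toV t) (u.toV t) (p.toV t)

end CBF

end

/-!
The cost is quadratic and the nonlinearities `B` and `𝒞` are polynomials of degree two and three, so
its expansion at `(u*, U*)` is exact. For a feasible pair `(z, W)` and `d = z - u*`, the terms of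
first order in `d` are the right-hand side of the adjoint equation tested with `d`, plus the boundary
terms at `0` and `T`. Testing the adjoint equation with `d` and the difference of the two state
equations with `p`, and integrating `(d, p)' = ⟨d', p⟩ + ⟨d, p'⟩` over `[0, T]`, turns them into the
second and third order remainders of `B` and `𝒞`; the conditions `p(T) = u*(T) - u_M^f` and
`U* = -p(0)` cancel the boundary terms. Hence `𝒥(z, W) - 𝒥(u*, U*)` *equals* the second order
expression in `(d, W - U*)` (`CBF.cost_eq_add_secondOrderForm`), which is nonnegative by assumption.

Three facts carry this computation.

* The product rule in time. A time derivative in `L^(4/3)(0, T; 𝕍')` cannot in general be paired with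
  `p ∈ L²(0, T; 𝕍)`. The equations give more: `|⟨u', v⟩| ≤ a ‖v‖_𝕍 + b ‖v‖_{L⁴}` with `a ∈ L²(0, T)`
  and `b ∈ L^(4/3)(0, T)`, while energy paths lie in `L²(0, T; 𝕍) ∩ L⁴(0, T; L⁴)`. With these bounds
  `CBF.inner_sub_inner_eq_integral` follows from the continuity of translations in `L²` and `L⁴`: the
  defect of the product rule over a time step `h`, integrated in time, is `o(h)`.
* Ladyzhenskaya's inequality `‖v‖²_{L⁴} ≤ C ‖v‖ ‖∇v‖` (`CBF.V.exists_eLpNorm_four_le`), which gives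
  the embedding `CBF.V.toL4` and the `L⁴` bound in time, and through Hölder's inequality all bounds
  for the trilinear form and the cubic term.
* `‖∇ × v‖ = ‖∇v‖` on `𝕍` (`CBF.curlSq_eq`), because `∂₁v₂ ∂₂v₁ - ∂₁v₁ ∂₂v₂` is a null Lagrangian.
  So the curl term of the cost has the Gateaux derivative `-Δu*` of the adjoint equation.

The initial condition holds only weakly, and the density of `𝕍` in `ℍ` makes it `u(0) = U`
(`CBF.EnergyPath.toH_zero_eq`).
-/

noncomputable section

open Filter Topology Set
open scoped ENNReal

namespace CBF

variable {O : Set Plane} {T : ℝ}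

/-! ### Hölder exponents -/

theorem inv_two_eq_ofReal : (2 : ℝ≥0∞)⁻¹ = ENNReal.ofReal (1 / 2) := by
  rw [ENNReal.ofReal_div_of_pos (by norm_num)]
  simp

theorem inv_four_eq_ofReal : (4 : ℝ≥0∞)⁻¹ = ENNReal.ofReal (1 / 4) := by
  rw [ENNReal.ofReal_div_of_pos (by norm_num)]
  simp

theorem inv_four_thirds_eq_ofReal : ((4 : ℝ≥0∞) / 3)⁻¹ = ENNReal.ofReal (3 / 4) := by
  rw [ENNReal.inv_div (by simp) (by simp), ENNReal.ofReal_div_of_pos (by norm_num)]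
  simp

instance holderTriple_four_thirds_four_one : ENNReal.HolderTriple (4 / 3) 4 1 where
  inv_add_inv_eq_inv := by
    rw [inv_four_thirds_eq_ofReal, inv_four_eq_ofReal,
      ← ENNReal.ofReal_add (by norm_num) (by norm_num)]
    norm_num

instance holderTriple_four_four_two : ENNReal.HolderTriple 4 4 2 where
  inv_add_inv_eq_inv := by
    rw [inv_four_eq_ofReal, inv_two_eq_ofReal, ← ENNReal.ofReal_add (by norm_num) (by norm_num)]
    norm_num

instance holderTriple_four_two_four_thirds : ENNReal.HolderTriple 4 2 (4 / 3) where
  inv_add_inv_eq_inv := by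
    rw [inv_four_thirds_eq_ofReal, inv_four_eq_ofReal, inv_two_eq_ofReal,
      ← ENNReal.ofReal_add (by norm_num) (by norm_num)]
    norm_num

instance fact_one_le_four : Fact ((1 : ℝ≥0∞) ≤ 4) := ⟨by norm_num⟩

/-! ### Translations in time -/

/-- Translations are continuous in `L^q(ℝ)` for `q < ∞`. -/
theorem tendsto_eLpNorm_translate_sub {F : Type*} [NormedAddCommGroup F] {q : ℝ≥0∞}
    [Fact (1 ≤ q)] (hq : q ≠ ⊤) {P : ℝ → F} (hP : MemLp P q volume) :
    Tendsto (fun σ => eLpNorm (fun r => P (r + σ) - P r) q volume) (𝓝 0) (𝓝 0) := by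
  have : Fact (q ≠ ⊤) := ⟨hq⟩
  have hc : Continuous (fun σ : ℝ => (DomAddAct.mk σ +ᵥ hP.toLp P : Lp F q volume)) := by
    have : Continuous (fun σ : ℝ => DomAddAct.mk σ) := DomAddAct.continuous_mk
    exact this.vadd continuous_const
  have h1 := (hc.tendsto 0).sub_const (hP.toLp P)
  have h2 := h1.enorm
  simp only [DomAddAct.mk_zero, zero_vadd, sub_self, enorm_zero] at h2
  refine h2.congr fun σ => ?_
  rw [Lp.enorm_def]
  refine eLpNorm_congr_ae ?_
  rw [DomAddAct.mk_vadd_toLp, ← MemLp.toLp_sub]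
  refine (MemLp.coeFn_toLp _).trans (Eventually.of_forall fun r => ?_)
  simp [add_comm]

theorem lintegral_enorm_mul_enorm_le {F : Type*} [NormedAddCommGroup F] [NormedSpace ℝ F]
    {p q : ℝ≥0∞} [ENNReal.HolderTriple p q 1] {a : ℝ → ℝ} {v : ℝ → F}
    (ha : AEStronglyMeasurable a volume) (hv : AEStronglyMeasurable v volume) :
    ∫⁻ r, ‖a r‖ₑ * ‖v r‖ₑ ≤ eLpNorm a p volume * eLpNorm v q volume := by
  have := eLpNorm_smul_le_mul_eLpNorm (p := p) (q := q) (r := 1) hv ha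
  rw [eLpNorm_one_eq_lintegral_enorm] at this
  simpa [enorm_smul] using this

section Translation

variable {E X : Type*} [NormedAddCommGroup E] [NormedSpace ℝ E]
  [NormedAddCommGroup X] [NormedSpace ℝ X]

/-- Functionals `G(r)` that are sums of an `L²` and an `L^(4/3)` part, in the sense of the bound
`hG`, are continuous in the mean along translations of paths in `L²(E) ∩ L⁴(X)`. -/
theorem tendsto_lintegral_apply_translate_sub (L : E →L[ℝ] X) {G : ℝ → E →L[ℝ] ℝ}
    {a b : ℝ → ℝ} (ha : MemLp a 2 volume) (hb : MemLp b (4 / 3) volume)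
    (hG : ∀ᵐ r, ∀ v, |G r v| ≤ a r * ‖v‖ + b r * ‖L v‖) {P : ℝ → E}
    (hP : MemLp P 2 volume) (hLP : MemLp (fun r => L (P r)) 4 volume) :
    Tendsto (fun σ => ∫⁻ r, ‖G r (P (r + σ) - P r)‖ₑ) (𝓝 0) (𝓝 0) := by
  have h1 := tendsto_eLpNorm_translate_sub (by norm_num) hP
  have h2 := tendsto_eLpNorm_translate_sub (by norm_num) hLP
  have h3 := (ENNReal.Tendsto.const_mul h1 (Or.inr ha.2.ne)).add
    (ENNReal.Tendsto.const_mul h2 (Or.inr hb.2.ne))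
  simp only [mul_zero, add_zero] at h3
  refine tendsto_of_tendsto_of_tendsto_of_le_of_le tendsto_const_nhds h3 (fun _ => zero_le)
    fun σ => ?_
  have hmP : AEStronglyMeasurable (fun r => P (r + σ) - P r) volume :=
    (hP.1.comp_quasiMeasurePreserving
      (measurePreserving_add_right volume σ).quasiMeasurePreserving).sub hP.1
  have hmL : AEStronglyMeasurable (fun r => L (P (r + σ)) - L (P r)) volume :=
    (hLP.1.comp_quasiMeasurePreserving
      (measurePreserving_add_right volume σ).quasiMeasurePreserving).sub hLP.1
  calc ∫⁻ r, ‖G r (P (r + σ) - P r)‖ₑ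
      ≤ ∫⁻ r, (‖a r‖ₑ * ‖P (r + σ) - P r‖ₑ + ‖b r‖ₑ * ‖L (P (r + σ)) - L (P r)‖ₑ) := by
        refine lintegral_mono_ae ?_
        filter_upwards [hG] with r hr
        have h := hr (P (r + σ) - P r)
        rw [← enorm_norm (P _ - _), ← enorm_norm (L _ - _), ← enorm_mul, ← enorm_mul,
          Real.enorm_eq_ofReal_abs, Real.enorm_eq_ofReal_abs, Real.enorm_eq_ofReal_abs,
          ← ENNReal.ofReal_add (abs_nonneg _) (abs_nonneg _), ← map_sub]
        exact ENNReal.ofReal_le_ofReal (h.trans (add_le_add (le_abs_self _) (le_abs_self _)))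
    _ = (∫⁻ r, ‖a r‖ₑ * ‖P (r + σ) - P r‖ₑ) +
          ∫⁻ r, ‖b r‖ₑ * ‖L (P (r + σ)) - L (P r)‖ₑ :=
        lintegral_add_left' (ha.1.enorm.mul hmP.enorm) _
    _ ≤ _ := add_le_add (lintegral_enorm_mul_enorm_le ha.1 hmP) (lintegral_enorm_mul_enorm_le hb.1 hmL)

theorem integrable_apply_of_bound (L : E →L[ℝ] X) {ν : Measure ℝ} {G : ℝ → E →L[ℝ] ℝ}
    (hGm : AEStronglyMeasurable G ν)
    {a b : ℝ → ℝ} (ha : MemLp a 2 ν) (hb : MemLp b (4 / 3) ν)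
    (hG : ∀ᵐ r ∂ν, ∀ v, |G r v| ≤ a r * ‖v‖ + b r * ‖L v‖) {P : ℝ → E}
    (hP : MemLp P 2 ν) (hLP : MemLp (fun r => L (P r)) 4 ν) :
    Integrable (fun r => G r (P r)) ν := by
  have h1 : Integrable (fun r => a r * ‖P r‖) ν :=
    memLp_one_iff_integrable.1 (hP.norm.mul ha)
  have h2 : Integrable (fun r => b r * ‖L (P r)‖) ν :=
    memLp_one_iff_integrable.1 (hLP.norm.mul hb)
  refine (h1.add h2).mono' 
    ((ContinuousLinearMap.id ℝ (E →L[ℝ] ℝ)).aestronglyMeasurable_comp₂ hGm hP.1) ?_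
  filter_upwards [hG] with r hr using hr _

/-- Tonelli's theorem in the coordinates `(r, r + σ)`, along parallels of the diagonal. -/
theorem lintegral_lintegral_Ioc_le {f : ℝ × ℝ → ℝ≥0∞} (hf : Measurable f) {h c : ℝ}
    {M : ℝ≥0∞} (hM : ∀ s ∈ Ioc 0 h, ∫⁻ r, f (r, r + (c - s)) ≤ M) :
    ∫⁻ t, ∫⁻ r in Ioc t (t + h), f (r, t + c) ≤ ENNReal.ofReal h * M := by
  have h1 : ∀ t, ∫⁻ r in Ioc t (t + h), f (r, t + c) = ∫⁻ s in Ioc 0 h, f (t + s, t + c) := by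
    intro t
    have hpre : (fun s => t + s) ⁻¹' (Ioc t (t + h)) = Ioc 0 h := by simp
    rw [← hpre]
    exact ((measurePreserving_add_left volume t).setLIntegral_comp_preimage
      measurableSet_Ioc (hf.comp (by fun_prop : Measurable fun r => (r, t + c)))).symm
  simp_rw [h1]
  rw [lintegral_lintegral_swap]
  · calc ∫⁻ s in Ioc 0 h, ∫⁻ t, f (t + s, t + c)
        ≤ ∫⁻ s in Ioc 0 h, M := by
          refine setLIntegral_mono measurable_const fun s hs => ?_
          refine le_trans (le_of_eq ?_) (hM s hs)
          rw [← lintegral_add_right_eq_self (fun r => f (r, r + (c - s))) s]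
          simp [add_assoc]
      _ = ENNReal.ofReal h * M := by
          simp [mul_comm]
  · exact (hf.comp (by fun_prop : Measurable fun x : ℝ × ℝ => (x.1 + x.2, x.1 + c))).aemeasurable

end Translation

/-! ### Distributional derivatives of scalar functions of time -/

theorem hasCompactSupport_deriv_smoothTransition :
    HasCompactSupport (deriv Real.smoothTransition) := by
  refine HasCompactSupport.intro (isCompact_Icc (a := (0 : ℝ)) (b := 1)) fun x hx => ?_
  rw [mem_Icc, not_and_or, not_le, not_le] at hx
  rcases hx with hx | hx
  · have : Real.smoothTransition =ᶠ[𝓝 x] fun _ => 0 := by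
      filter_upwards [Iio_mem_nhds hx] with y hy
      exact Real.smoothTransition.zero_of_nonpos (le_of_lt hy)
    rw [this.deriv_eq]; simp
  · have : Real.smoothTransition =ᶠ[𝓝 x] fun _ => 1 := by
      filter_upwards [Ioi_mem_nhds hx] with y hy
      exact Real.smoothTransition.one_of_one_le (le_of_lt hy)
    rw [this.deriv_eq]; simp

theorem continuous_deriv_smoothTransition : Continuous (deriv Real.smoothTransition) :=
  (Real.smoothTransition.contDiff (n := 1)).continuous_deriv (by simp)

theorem integral_deriv_smoothTransition : ∫ x, deriv Real.smoothTransition x = 1 := by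
  have h := integral_of_hasDerivAt_of_tendsto (f := Real.smoothTransition)
    (f' := deriv Real.smoothTransition) (m := 0) (n := 1)
    (fun x => ((Real.smoothTransition.contDiff (n := 1)).differentiable (by simp) x).hasDerivAt)
    (continuous_deriv_smoothTransition.integrable_of_hasCompactSupport
      hasCompactSupport_deriv_smoothTransition)
    (tendsto_const_nhds.congr' (by
      filter_upwards [Iic_mem_atBot 0] with y hy
      exact (Real.smoothTransition.zero_of_nonpos hy).symm))
    (tendsto_const_nhds.congr' (by
      filter_upwards [Ici_mem_atTop 1] with y hy
      exact (Real.smoothTransition.one_of_one_le hy).symm))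
  simpa using h

/-- The derivative of `x ↦ smoothTransition (n (x - s))` is an approximate identity at `s`. -/
theorem tendsto_integral_deriv_smoothTransition_mul {w : ℝ → ℝ} (hw : Continuous w) {C : ℝ}
    (hC : ∀ x, |w x| ≤ C) (s : ℝ) :
    Tendsto (fun n : ℕ => ∫ x, (n * deriv Real.smoothTransition (n * (x - s))) * w x)
      atTop (𝓝 (w s)) := by
  have h1 : ∀ᶠ n : ℕ in atTop,
      ∫ y, deriv Real.smoothTransition y * w (s + y / n) =
      ∫ x, (n * deriv Real.smoothTransition (n * (x - s))) * w x := by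
    filter_upwards [eventually_gt_atTop 0] with n hn
    have hn' : (0 : ℝ) < n := by exact_mod_cast hn
    rw [← integral_sub_right_eq_self
      (fun x => (n * deriv Real.smoothTransition (n * (x - s))) * w x) (-s)]
    have := Measure.integral_comp_mul_left
      (fun y => deriv Real.smoothTransition y * w (s + y / n)) (n : ℝ)
    rw [abs_of_pos (by positivity), eq_comm, inv_smul_eq_iff₀ hn'.ne', smul_eq_mul,
      ← integral_const_mul] at this
    rw [this]
    congr 1
    ext x
    rw [mul_div_cancel_left₀ _ hn'.ne']
    simp [add_comm, mul_assoc]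
  refine Tendsto.congr' h1 ?_
  have h2 : w s = ∫ y, deriv Real.smoothTransition y * w s := by
    rw [integral_mul_const, integral_deriv_smoothTransition, one_mul]
  rw [h2]
  have hint := (continuous_deriv_smoothTransition.integrable_of_hasCompactSupport (μ := volume)
      hasCompactSupport_deriv_smoothTransition)
  refine tendsto_integral_of_dominated_convergence
    (fun y => ‖deriv Real.smoothTransition y‖ * C) ?_ (hint.norm.mul_const C) ?_ ?_
  · intro n
    exact (continuous_deriv_smoothTransition.mul
      (hw.comp (by fun_prop))).aestronglyMeasurable
  · intro n
    refine Eventually.of_forall fun y => ?_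
    rw [norm_mul]
    exact mul_le_mul_of_nonneg_left (hC _) (norm_nonneg _)
  · refine Eventually.of_forall fun y => ?_
    refine Tendsto.const_mul _ ((hw.tendsto s).comp ?_)
    have : Tendsto (fun n : ℕ => s + y / (n : ℝ)) atTop (𝓝 (s + 0)) :=
      (tendsto_const_div_atTop_nhds_zero_nat y).const_add s
    simpa using this

theorem tendsto_smoothTransition_mul_sub (s x : ℝ) :
    Tendsto (fun n : ℕ => Real.smoothTransition (n * (x - s))) atTop
      (𝓝 (if s < x then 1 else 0)) := by
  split_ifs with h
  · refine tendsto_const_nhds.congr' ?_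
    have : Tendsto (fun n : ℕ => (n : ℝ) * (x - s)) atTop atTop :=
      tendsto_natCast_atTop_atTop.atTop_mul_const (by linarith)
    filter_upwards [this.eventually_ge_atTop 1] with n hn
    exact (Real.smoothTransition.one_of_one_le hn).symm
  · refine tendsto_const_nhds.congr fun n => ?_
    refine (Real.smoothTransition.zero_of_nonpos ?_).symm
    exact mul_nonpos_of_nonneg_of_nonpos (Nat.cast_nonneg n) (by linarith)

/-- A continuous function with an integrable distributional derivative is the integral of that
derivative. -/
theorem sub_eq_integral_of_forall_test {T : ℝ} {w k : ℝ → ℝ} (hw : ContinuousOn w (Icc 0 T))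
    (hk : IntervalIntegrable k volume 0 T)
    (h : ∀ φ : ℝ → ℝ, ContDiff ℝ ∞ φ → HasCompactSupport φ → tsupport φ ⊆ Ioo 0 T →
      ∫ t in (0 : ℝ)..T, deriv φ t * w t = - ∫ t in (0 : ℝ)..T, φ t * k t)
    {s t : ℝ} (hs : 0 < s) (hst : s ≤ t) (ht : t < T) :
    w t - w s = ∫ r in s..t, k r := by
  have hT : 0 ≤ T := by linarith
  -- the test functions increase from `0` to `1` just after `s` and back to `0` just after `t`
  let φ : ℕ → ℝ → ℝ := fun n x =>
    Real.smoothTransition (n * (x - s)) - Real.smoothTransition (n * (x - t))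
  have hφ : ∀ n, ContDiff ℝ ∞ (φ n) := fun n =>
    (Real.smoothTransition.contDiff.comp (by fun_prop)).sub
      (Real.smoothTransition.contDiff.comp (by fun_prop))
  have hφd : ∀ n x, deriv (φ n) x = n * deriv Real.smoothTransition (n * (x - s)) -
      n * deriv Real.smoothTransition (n * (x - t)) := by
    intro n x
    have hS : ∀ y, HasDerivAt Real.smoothTransition (deriv Real.smoothTransition y) y := fun y =>
      ((Real.smoothTransition.contDiff (n := 1)).differentiable (by simp) y).hasDerivAt
    have hc : ∀ c : ℝ, HasDerivAt (fun x => Real.smoothTransition (n * (x - c)))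
        (n * deriv Real.smoothTransition (n * (x - c))) x := by
      intro c
      have h1 : HasDerivAt (fun x : ℝ => (n : ℝ) * (x - c)) n x := by
        simpa using ((hasDerivAt_id x).sub_const c).const_mul (n : ℝ)
      have := (hS _).comp x h1
      rwa [mul_comm] at this
    exact ((hc s).sub (hc t)).deriv
  have hsupp : ∀ᶠ n : ℕ in atTop, tsupport (φ n) ⊆ Icc s ((t + T) / 2) := by
    have : Tendsto (fun n : ℕ => (n : ℝ) * ((T - t) / 2)) atTop atTop :=
      tendsto_natCast_atTop_atTop.atTop_mul_const (by linarith)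
    filter_upwards [this.eventually_ge_atTop 1] with n hn
    refine closure_minimal (fun x hx => ?_) isClosed_Icc
    by_contra hx'
    apply hx
    rw [mem_Icc, not_and_or, not_le, not_le] at hx'
    have hn0 : (0 : ℝ) ≤ n := Nat.cast_nonneg n
    rcases hx' with hx' | hx'
    · simp only [φ]
      rw [Real.smoothTransition.zero_of_nonpos, Real.smoothTransition.zero_of_nonpos, sub_zero]
      · exact mul_nonpos_of_nonneg_of_nonpos hn0 (by linarith)
      · exact mul_nonpos_of_nonneg_of_nonpos hn0 (by linarith)
    · simp only [φ]
      rw [Real.smoothTransition.one_of_one_le, Real.smoothTransition.one_of_one_le, sub_self]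
      · exact hn.trans (mul_le_mul_of_nonneg_left (by linarith) hn0)
      · exact hn.trans (mul_le_mul_of_nonneg_left (by linarith) hn0)
  -- the extension of `w` by its boundary values is continuous and bounded
  let w' : ℝ → ℝ := IccExtend hT ((Icc 0 T).domRestrict w)
  have hw' : Continuous w' := (continuousOn_iff_continuous_domRestrict.1 hw).Icc_extend'
  have hww' : ∀ x ∈ Icc 0 T, w' x = w x := fun x hx => IccExtend_of_mem hT _ hx
  obtain ⟨C, hC⟩ : ∃ C, ∀ x, |w' x| ≤ C := by
    obtain ⟨C, hC⟩ := isCompact_Icc.exists_bound_of_continuousOn hw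
    exact ⟨C, fun x => hC _ (projIcc 0 T hT x).2⟩
  have hcs : ∀ n : ℕ, 0 < n → ∀ c : ℝ,
      Integrable (fun x => (n * deriv Real.smoothTransition (n * (x - c))) * w' x) := by
    intro n hn c
    refine Continuous.integrable_of_hasCompactSupport ?_ ?_
    · exact (continuous_const.mul
        (continuous_deriv_smoothTransition.comp (by fun_prop))).mul hw'
    · refine HasCompactSupport.mul_right (HasCompactSupport.mul_left ?_)
      have hn' : (n : ℝ) ≠ 0 := by exact_mod_cast hn.ne'
      exact hasCompactSupport_deriv_smoothTransition.comp_homeomorph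
        ((Homeomorph.subRight c).trans (Homeomorph.mulLeft₀ (n : ℝ) hn'))
  have hlim1 : Tendsto (fun n => ∫ x in (0 : ℝ)..T, deriv (φ n) x * w x) atTop
      (𝓝 (w' s - w' t)) := by
    refine ((tendsto_integral_deriv_smoothTransition_mul hw' hC s).sub
      (tendsto_integral_deriv_smoothTransition_mul hw' hC t)).congr' ?_
    filter_upwards [hsupp, eventually_gt_atTop 0] with n hn hn0
    rw [← integral_sub (hcs n hn0 s) (hcs n hn0 t), intervalIntegral.integral_of_le hT,
      ← setIntegral_eq_integral_of_forall_compl_eq_zero (s := Ioc 0 T)]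
    · refine setIntegral_congr_fun measurableSet_Ioc fun x hx => ?_
      rw [hφd, hww' x ⟨hx.1.le, hx.2⟩]
      ring
    · intro x hx
      have hx0 : deriv (φ n) x = 0 := by
        by_contra hne
        have := hn (support_deriv_subset (Function.mem_support.2 hne))
        exact hx ⟨by linarith [this.1], by linarith [this.2]⟩
      rw [← sub_mul, ← hφd, hx0, zero_mul]
  have hlim2 : Tendsto (fun n => ∫ x in (0 : ℝ)..T, φ n x * k x) atTop
      (𝓝 (∫ x in s..t, k x)) := by
    have hst' : ∫ x in s..t, k x = ∫ x in (0 : ℝ)..T,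
        ((if s < x then (1 : ℝ) else 0) - (if t < x then 1 else 0)) * k x := by
      rw [intervalIntegral.integral_of_le hst, intervalIntegral.integral_of_le hT,
        ← integral_indicator measurableSet_Ioc, ← integral_indicator measurableSet_Ioc]
      congr 1
      ext x
      simp only [indicator, mem_Ioc]
      split_ifs <;> first | (simp; done) | (exfalso; grind)
    rw [hst', intervalIntegral.integral_of_le hT]
    simp_rw [intervalIntegral.integral_of_le hT]
    have hk' : Integrable k (volume.restrict (Ioc 0 T)) :=
      (intervalIntegrable_iff_integrableOn_Ioc_of_le hT).1 hk
    refine tendsto_integral_of_dominated_convergence (fun x => ‖k x‖) ?_ hk'.norm ?_ ?_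
    · intro n
      exact (hφ n).continuous.aestronglyMeasurable.mul hk'.1
    · intro n
      refine Eventually.of_forall fun x => ?_
      rw [norm_mul]
      refine mul_le_of_le_one_left (norm_nonneg _) ?_
      rw [Real.norm_eq_abs, abs_le]
      constructor <;>
      linarith [Real.smoothTransition.nonneg (n * (x - s)), Real.smoothTransition.le_one (n * (x - s)),
        Real.smoothTransition.nonneg (n * (x - t)), Real.smoothTransition.le_one (n * (x - t))]
    · refine Eventually.of_forall fun x => Tendsto.mul_const _ ?_
      exact (tendsto_smoothTransition_mul_sub s x).sub (tendsto_smoothTransition_mul_sub t x)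
  have hkey : w' s - w' t = - ∫ x in s..t, k x := by
    refine tendsto_nhds_unique hlim1 (hlim2.neg.congr' ?_)
    filter_upwards [hsupp] with n hn
    refine (h (φ n) (hφ n) (isCompact_Icc.of_isClosed_subset (isClosed_tsupport _) hn)
      (hn.trans fun x hx => ⟨by linarith [hx.1], by linarith [hx.2]⟩)).symm
  rw [hww' s ⟨hs.le, by linarith⟩, hww' t ⟨by linarith, ht.le⟩] at hkey
  linarith

/-! ### The product rule for weak time derivatives -/

section ProductRule

variable {E H : Type*} [NormedAddCommGroup E] [NormedSpace ℝ E]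
  [NormedAddCommGroup H] [InnerProductSpace ℝ H]

theorem intervalIntegrable_clm_apply {G : ℝ → E →L[ℝ] ℝ} (hG : Integrable G volume) (v : E)
    (s t : ℝ) : IntervalIntegrable (fun r => G r v) volume s t :=
  (hG.apply_continuousLinearMap v).intervalIntegrable

/-- If the increments `W(t + h) - W(t)` of a continuous function have an integral `o(h)` over `[a, b]`
as `h ↓ 0`, then `W a = W b`. -/
theorem eq_of_forall_enorm_integral_translate_sub_le {W : ℝ → ℝ} (hW : Continuous W) {a b : ℝ}
    (h : ∀ ε : ℝ≥0∞, 0 < ε → ∀ᶠ h in 𝓝[>] (0 : ℝ),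
      ‖∫ t in a..b, (W (t + h) - W t)‖ₑ ≤ ENNReal.ofReal h * ε) : W a = W b := by
  let F : ℝ → ℝ := fun h => ∫ t in (a + h)..(b + h), W t
  -- `F h - F 0` is the integral of the increments, and its slope at `0` is `W b - W a`
  have hF : HasDerivAt F (W b - W a) 0 := by
    let K : ℝ → ℝ := fun x => ∫ t in (0 : ℝ)..x, W t
    have hK : ∀ x, HasDerivAt K (W x) x := fun x => hW.integral_hasStrictDerivAt 0 x |>.hasDerivAt
    have h1 : ∀ c : ℝ, HasDerivAt (fun h => K (c + h)) (W c) 0 := by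
      intro c
      have h2 := hK (c + 0)
      simpa using h2.comp_const_add c 0
    refine ((h1 b).sub (h1 a)).congr_of_eventuallyEq (Eventually.of_forall fun h => ?_)
    exact (intervalIntegral.integral_interval_sub_left (hW.intervalIntegrable _ _)
      (hW.intervalIntegrable _ _)).symm
  have hlim := hF.tendsto_slope_zero_right.enorm
  have hz : ∀ ε : ℝ≥0∞, 0 < ε → ‖W b - W a‖ₑ ≤ ε := by
    intro ε hε
    refine le_of_tendsto hlim ?_
    filter_upwards [h ε hε, self_mem_nhdsWithin] with x hx hx0
    rw [mem_Ioi] at hx0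
    have hFx : F (0 + x) - F 0 = ∫ t in a..b, (W (t + x) - W t) := by
      have hc : Continuous fun t => W (t + x) := by fun_prop
      rw [intervalIntegral.integral_sub (hc.intervalIntegrable _ _)
        (hW.intervalIntegrable _ _), intervalIntegral.integral_comp_add_right (f := W)]
      simp [F]
    rw [hFx, enorm_smul]
    calc ‖x⁻¹‖ₑ * ‖∫ t in a..b, (W (t + x) - W t)‖ₑ
        ≤ ‖x⁻¹‖ₑ * (ENNReal.ofReal x * ε) := by gcongr
      _ = ε := by
        rw [← mul_assoc, Real.enorm_eq_ofReal (by positivity),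
          ← ENNReal.ofReal_mul (by positivity), inv_mul_cancel₀ hx0.ne', ENNReal.ofReal_one,
          one_mul]
  have : ‖W b - W a‖ₑ = 0 := by
    by_contra hne
    obtain ⟨ε, hε, hε'⟩ := exists_between (pos_iff_ne_zero.2 hne)
    exact absurd (hz ε hε) (not_le.2 hε')
  rw [enorm_eq_zero] at this
  linarith

/-- The product rule for paths and derivatives that are defined on all of `ℝ`, under the abstract
condition that `G` and `Q` are continuous in the mean along translations of `P` and `U`.

The function `W(t) = (u(t), p(t)) - ∫₀ᵗ (⟨G, P⟩ + ⟨Q, U⟩)` has the increment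
`W(t + h) - W(t) = ∫ₜ^{t+h} ⟨G(r), P(t + h) - P(r)⟩ dr + ∫ₜ^{t+h} ⟨Q(r), U(t) - U(r)⟩ dr`,
whose integral over `t` is `o(h)`, and `W` is therefore constant. -/
theorem inner_sub_inner_eq_integral_aux (ι : E →L[ℝ] H) {T : ℝ} (hT : 0 < T) {u p : ℝ → H}
    {U P : ℝ → E} {G Q : ℝ → E →L[ℝ] ℝ} (hu : ContinuousOn u (Icc 0 T))
    (hp : ContinuousOn p (Icc 0 T)) (hUm : StronglyMeasurable U) (hPm : StronglyMeasurable P)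
    (hGm : StronglyMeasurable G) (hQm : StronglyMeasurable Q)
    (hUu : ∀ᵐ t, t ∈ Ioc 0 T → ι (U t) = u t) (hPp : ∀ᵐ t, t ∈ Ioc 0 T → ι (P t) = p t)
    (hG : Integrable G volume) (hQ : Integrable Q volume)
    (hGP : Integrable (fun r => G r (P r)) volume) (hQU : Integrable (fun r => Q r (U r)) volume)
    (hGt : Tendsto (fun σ => ∫⁻ r, ‖G r (P (r + σ) - P r)‖ₑ) (𝓝 0) (𝓝 0))
    (hQt : Tendsto (fun σ => ∫⁻ r, ‖Q r (U (r + σ) - U r)‖ₑ) (𝓝 0) (𝓝 0))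
    (hGu : ∀ s t, 0 < s → s ≤ t → t < T → ∀ v,
      inner ℝ (u t) (ι v) - inner ℝ (u s) (ι v) = ∫ r in s..t, G r v)
    (hQp : ∀ s t, 0 < s → s ≤ t → t < T → ∀ v,
      inner ℝ (p t) (ι v) - inner ℝ (p s) (ι v) = ∫ r in s..t, Q r v) :
    inner ℝ (u T) (p T) - inner ℝ (u 0) (p 0) = ∫ t in (0 : ℝ)..T, (G t (P t) + Q t (U t)) := by
  let k : ℝ → ℝ := fun r => G r (P r) + Q r (U r)
  have hk : Integrable k volume := hGP.add hQU
  let W : ℝ → ℝ := fun t => inner ℝ (u t) (p t) - ∫ r in (0 : ℝ)..t, k r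
  have hW : ContinuousOn W (Icc 0 T) :=
    (hu.inner hp).sub (intervalIntegral.continuous_primitive
      (fun _ _ => hk.intervalIntegrable) 0).continuousOn
  let W' : ℝ → ℝ := IccExtend hT.le ((Icc 0 T).domRestrict W)
  have hW' : Continuous W' := (continuousOn_iff_continuous_domRestrict.1 hW).Icc_extend'
  have hWW' : ∀ x ∈ Icc 0 T, W' x = W x := fun x hx => IccExtend_of_mem hT.le _ hx
  have hf1 : Measurable (fun z : ℝ × ℝ => ‖G z.1 (P z.2 - P z.1)‖ₑ) :=
    ((ContinuousLinearMap.id ℝ (E →L[ℝ] ℝ)).continuous₂.comp_stronglyMeasurable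
      ((hGm.comp_measurable measurable_fst).prodMk
        ((hPm.comp_measurable measurable_snd).sub
          (hPm.comp_measurable measurable_fst)))).enorm
  have hf2 : Measurable (fun z : ℝ × ℝ => ‖Q z.1 (U z.2 - U z.1)‖ₑ) :=
    ((ContinuousLinearMap.id ℝ (E →L[ℝ] ℝ)).continuous₂.comp_stronglyMeasurable
      ((hQm.comp_measurable measurable_fst).prodMk
        ((hUm.comp_measurable measurable_snd).sub
          (hUm.comp_measurable measurable_fst)))).enorm
  have hconst : ∀ a b, 0 < a → a ≤ b → b < T → W a = W b := by
    intro a b ha hab hb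
    rw [← hWW' a ⟨ha.le, by linarith⟩, ← hWW' b ⟨by linarith, hb.le⟩]
    refine eq_of_forall_enorm_integral_translate_sub_le hW' fun ε hε => ?_
    have hε2 : 0 < ε / 2 := ENNReal.half_pos hε.ne'
    obtain ⟨δ, hδ, hδ'⟩ := Metric.eventually_nhds_iff.1
      (((ENNReal.tendsto_nhds_zero.1 hGt) _ hε2).and ((ENNReal.tendsto_nhds_zero.1 hQt) _ hε2))
    have hmem : ∀ᶠ h in 𝓝[>] (0 : ℝ), h ∈ Ioo 0 (min δ (T - b)) :=
      Ioo_mem_nhdsGT (lt_min hδ (by linarith))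
    filter_upwards [hmem] with h hh
    have hh0 := hh.1
    have hhδ := lt_of_lt_of_le hh.2 (min_le_left _ _)
    have hhT := lt_of_lt_of_le hh.2 (min_le_right _ _)
    -- `P` is a version of `p` at almost every translated time `t + h` as well
    have hPp' : ∀ᵐ t, t + h ∈ Ioc 0 T → ι (P (t + h)) = p (t + h) :=
      (measurePreserving_add_right volume h).quasiMeasurePreserving.ae hPp
    have hpt : ∀ᵐ t ∂(volume.restrict (Ioc a b)), ‖W' (t + h) - W' t‖ₑ ≤
        (∫⁻ r in Ioc t (t + h), ‖G r (P (t + h) - P r)‖ₑ) +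
          ∫⁻ r in Ioc t (t + h), ‖Q r (U (t + 0) - U r)‖ₑ := by
      rw [ae_restrict_iff' measurableSet_Ioc]
      filter_upwards [hPp', hUu] with t hPt hUt ht
      have hPt' := hPt ⟨by linarith [ht.1], by linarith [ht.2]⟩
      have hUt' := hUt ⟨by linarith [ht.1], by linarith [ht.2]⟩
      rw [hWW' (t + h) ⟨by linarith [ht.1], by linarith [ht.2]⟩,
        hWW' t ⟨by linarith [ht.1], by linarith [ht.2]⟩]
      have e1 := hGu t (t + h) (by linarith [ht.1]) (by linarith) (by linarith [ht.2]) (P (t + h))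
      have e2 := hQp t (t + h) (by linarith [ht.1]) (by linarith) (by linarith [ht.2]) (U t)
      rw [hPt'] at e1
      rw [hUt', real_inner_comm, real_inner_comm _ (p t)] at e2
      have i1 : IntervalIntegrable (fun r => G r (P (t + h) - P r)) volume t (t + h) := by
        simpa only [map_sub] using
          (intervalIntegrable_clm_apply hG (P (t + h)) t (t + h)).sub hGP.intervalIntegrable
      have i2 : IntervalIntegrable (fun r => Q r (U t - U r)) volume t (t + h) := by
        simpa only [map_sub] using
          (intervalIntegrable_clm_apply hQ (U t) t (t + h)).sub hQU.intervalIntegrable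
      have e3 : (∫ r in (0 : ℝ)..(t + h), k r) - ∫ r in (0 : ℝ)..t, k r = ∫ r in t..(t + h), k r :=
        intervalIntegral.integral_interval_sub_left hk.intervalIntegrable hk.intervalIntegrable
      have e4 : W (t + h) - W t = (∫ r in t..(t + h), G r (P (t + h) - P r)) +
          ∫ r in t..(t + h), Q r (U t - U r) := by
        have d1 : ∫ r in t..(t + h), G r (P (t + h) - P r) =
            (∫ r in t..(t + h), G r (P (t + h))) - ∫ r in t..(t + h), G r (P r) := by
          simp only [map_sub]
          exact intervalIntegral.integral_sub (intervalIntegrable_clm_apply hG _ _ _)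
            hGP.intervalIntegrable
        have d2 : ∫ r in t..(t + h), Q r (U t - U r) =
            (∫ r in t..(t + h), Q r (U t)) - ∫ r in t..(t + h), Q r (U r) := by
          simp only [map_sub]
          exact intervalIntegral.integral_sub (intervalIntegrable_clm_apply hQ _ _ _)
            hQU.intervalIntegrable
        have d3 : ∫ r in t..(t + h), k r = (∫ r in t..(t + h), G r (P r)) +
            ∫ r in t..(t + h), Q r (U r) :=
          intervalIntegral.integral_add hGP.intervalIntegrable hQU.intervalIntegrable
        simp only [W]
        linarith
      rw [e4, intervalIntegral.integral_of_le (by linarith),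
        intervalIntegral.integral_of_le (by linarith), add_zero]
      exact (enorm_add_le _ _).trans
        (add_le_add (enorm_integral_le_lintegral_enorm _) (enorm_integral_le_lintegral_enorm _))
    have hm1 : Measurable (fun t => ∫⁻ r in Ioc t (t + h), ‖G r (P (t + h) - P r)‖ₑ) := by
      have : (fun t => ∫⁻ r in Ioc t (t + h), ‖G r (P (t + h) - P r)‖ₑ) = fun t =>
          ∫⁻ r, {z : ℝ × ℝ | z.1 < z.2 ∧ z.2 ≤ z.1 + h}.indicator
            (fun z => ‖G z.2 (P (z.1 + h) - P z.2)‖ₑ) (t, r) := by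
        ext t
        rw [← lintegral_indicator measurableSet_Ioc]
        rfl
      rw [this]
      refine Measurable.lintegral_prod_right' (Measurable.indicator ?_ ?_)
      · exact hf1.comp (by fun_prop : Measurable fun z : ℝ × ℝ => (z.2, z.1 + h))
      · exact (measurableSet_lt measurable_fst measurable_snd).inter
          (measurableSet_le measurable_snd (measurable_fst.add_const h))
    calc ‖∫ t in a..b, (W' (t + h) - W' t)‖ₑ
        ≤ ∫⁻ t in Ioc a b, ‖W' (t + h) - W' t‖ₑ := by
          rw [intervalIntegral.integral_of_le hab]
          exact enorm_integral_le_lintegral_enorm _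
      _ ≤ ∫⁻ t in Ioc a b, ((∫⁻ r in Ioc t (t + h), ‖G r (P (t + h) - P r)‖ₑ) +
          ∫⁻ r in Ioc t (t + h), ‖Q r (U (t + 0) - U r)‖ₑ) := lintegral_mono_ae hpt
      _ ≤ ∫⁻ t, ((∫⁻ r in Ioc t (t + h), ‖G r (P (t + h) - P r)‖ₑ) +
          ∫⁻ r in Ioc t (t + h), ‖Q r (U (t + 0) - U r)‖ₑ) :=
          setLIntegral_le_lintegral _ _
      _ = (∫⁻ t, ∫⁻ r in Ioc t (t + h), ‖G r (P (t + h) - P r)‖ₑ) +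
          ∫⁻ t, ∫⁻ r in Ioc t (t + h), ‖Q r (U (t + 0) - U r)‖ₑ :=
          lintegral_add_left hm1 _
      _ ≤ ENNReal.ofReal h * (ε / 2) + ENNReal.ofReal h * (ε / 2) := by
          refine add_le_add
            (lintegral_lintegral_Ioc_le hf1 (c := h) fun s hs => ?_)
            (lintegral_lintegral_Ioc_le hf2 (c := 0) fun s hs => ?_)
          · refine (hδ' ?_).1
            rw [Real.dist_eq, sub_zero, abs_lt]
            constructor <;> linarith [hs.1, hs.2]
          · refine (hδ' ?_).2
            rw [Real.dist_eq, sub_zero, abs_lt]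
            constructor <;> linarith [hs.1, hs.2]
      _ = ENNReal.ofReal h * ε := by rw [← mul_add, ENNReal.add_halves]
  -- constancy on the open interval extends to its end points by continuity
  have hWT : W 0 = W T := by
    have hmid : ∀ x ∈ Ioo 0 T, W' x = W (T / 2) := by
      intro x hx
      rw [hWW' x ⟨hx.1.le, hx.2.le⟩]
      rcases le_total x (T / 2) with h | h
      · exact hconst x (T / 2) hx.1 h (by linarith)
      · exact (hconst (T / 2) x (by linarith) h hx.2).symm
    have hcl : ∀ x ∈ Icc 0 T, W' x = W (T / 2) := by
      intro x hx
      have : closure (Ioo 0 T) ⊆ {x | W' x = W (T / 2)} :=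
        closure_minimal hmid (isClosed_eq hW' continuous_const)
      rw [closure_Ioo hT.ne] at this
      exact this hx
    rw [← hWW' 0 ⟨le_rfl, hT.le⟩, ← hWW' T ⟨hT.le, le_rfl⟩, hcl 0 ⟨le_rfl, hT.le⟩,
      hcl T ⟨hT.le, le_rfl⟩]
  simp only [W, intervalIntegral.integral_same, sub_zero] at hWT
  change _ = ∫ t in (0 : ℝ)..T, k t
  linarith

variable {X : Type*} [NormedAddCommGroup X] [NormedSpace ℝ X]

/-- Strongly measurable extension by zero of a class given on `s`. -/
theorem exists_stronglyMeasurable_extension {F : Type*} [NormedAddCommGroup F] {s : Set ℝ}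
    (hs : MeasurableSet s) {f : ℝ → F} (hf : AEStronglyMeasurable f (volume.restrict s)) :
    ∃ f' : ℝ → F, StronglyMeasurable f' ∧ f' =ᵐ[volume.restrict s] f ∧ f' = s.indicator f' := by
  refine ⟨s.indicator (hf.mk f), hf.stronglyMeasurable_mk.indicator hs, ?_,
    by rw [indicator_indicator, inter_self]⟩
  exact (indicator_ae_eq_restrict hs).trans hf.ae_eq_mk.symm

theorem memLp_of_ae_eq_of_eq_indicator {F : Type*} [NormedAddCommGroup F] {s : Set ℝ}
    (hs : MeasurableSet s) {f f' : ℝ → F} {q : ℝ≥0∞} (hf : MemLp f q (volume.restrict s))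
    (h : f' =ᵐ[volume.restrict s] f) (hi : f' = s.indicator f') : MemLp f' q volume := by
  rw [hi, memLp_indicator_iff_restrict hs]
  exact (memLp_congr_ae h).2 hf

/-- The product rule `(u, p)' = ⟨u', p⟩ + ⟨u, p'⟩`, integrated over `[0, T]`, for two continuous
`H`-valued paths with `E`-valued versions `U, P ∈ L²(0, T; E) ∩ L⁴(0, T; X)` and derivatives
`G`, `Q` that are sums of an `L²(0, T; E')` and an `L^(4/3)(0, T; X')` part in the sense of the
bounds `hGb`, `hQb`. -/
theorem inner_sub_inner_eq_integral (ι : E →L[ℝ] H) (L : E →L[ℝ] X) {T : ℝ} (hT : 0 < T)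
    {u p : ℝ → H} {U P : ℝ → E} {G Q : ℝ → E →L[ℝ] ℝ} {aG bG aQ bQ : ℝ → ℝ}
    (hu : ContinuousOn u (Icc 0 T)) (hp : ContinuousOn p (Icc 0 T))
    (hU : MemLp U 2 (volume.restrict (Ioc 0 T))) (hP : MemLp P 2 (volume.restrict (Ioc 0 T)))
    (hLU : MemLp (fun t => L (U t)) 4 (volume.restrict (Ioc 0 T)))
    (hLP : MemLp (fun t => L (P t)) 4 (volume.restrict (Ioc 0 T)))
    (hUu : ∀ᵐ t ∂(volume.restrict (Ioc 0 T)), ι (U t) = u t)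
    (hPp : ∀ᵐ t ∂(volume.restrict (Ioc 0 T)), ι (P t) = p t)
    (hG : Integrable G (volume.restrict (Ioc 0 T))) (hQ : Integrable Q (volume.restrict (Ioc 0 T)))
    (haG : MemLp aG 2 (volume.restrict (Ioc 0 T)))
    (hbG : MemLp bG (4 / 3) (volume.restrict (Ioc 0 T)))
    (haQ : MemLp aQ 2 (volume.restrict (Ioc 0 T)))
    (hbQ : MemLp bQ (4 / 3) (volume.restrict (Ioc 0 T)))
    (hGb : ∀ᵐ t ∂(volume.restrict (Ioc 0 T)), ∀ v, |G t v| ≤ aG t * ‖v‖ + bG t * ‖L v‖)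
    (hQb : ∀ᵐ t ∂(volume.restrict (Ioc 0 T)), ∀ v, |Q t v| ≤ aQ t * ‖v‖ + bQ t * ‖L v‖)
    (hGu : ∀ s t, 0 < s → s ≤ t → t < T → ∀ v,
      inner ℝ (u t) (ι v) - inner ℝ (u s) (ι v) = ∫ r in s..t, G r v)
    (hQp : ∀ s t, 0 < s → s ≤ t → t < T → ∀ v,
      inner ℝ (p t) (ι v) - inner ℝ (p s) (ι v) = ∫ r in s..t, Q r v) :
    inner ℝ (u T) (p T) - inner ℝ (u 0) (p 0) = ∫ t in (0 : ℝ)..T, (G t (P t) + Q t (U t)) := by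
  have hs : MeasurableSet (Ioc 0 T) := measurableSet_Ioc
  obtain ⟨U', hUm, hU', hUi⟩ := exists_stronglyMeasurable_extension hs hU.1
  obtain ⟨P', hPm, hP', hPi⟩ := exists_stronglyMeasurable_extension hs hP.1
  obtain ⟨G', hGm, hG', hGi⟩ := exists_stronglyMeasurable_extension hs hG.1
  obtain ⟨Q', hQm, hQ', hQi⟩ := exists_stronglyMeasurable_extension hs hQ.1
  have hU2 := memLp_of_ae_eq_of_eq_indicator hs hU hU' hUi
  have hP2 := memLp_of_ae_eq_of_eq_indicator hs hP hP' hPi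
  have hG2 := memLp_one_iff_integrable.1
    (memLp_of_ae_eq_of_eq_indicator hs (memLp_one_iff_integrable.2 hG) hG' hGi)
  have hQ2 := memLp_one_iff_integrable.1
    (memLp_of_ae_eq_of_eq_indicator hs (memLp_one_iff_integrable.2 hQ) hQ' hQi)
  have hL : ∀ {V V' : ℝ → E}, MemLp (fun t => L (V t)) 4 (volume.restrict (Ioc 0 T)) →
      V' =ᵐ[volume.restrict (Ioc 0 T)] V → V' = (Ioc 0 T).indicator V' →
      MemLp (fun t => L (V' t)) 4 volume := by
    intro V V' h1 h2 h3
    refine memLp_of_ae_eq_of_eq_indicator hs h1 (h2.fun_comp L) ?_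
    ext t
    by_cases ht : t ∈ Ioc 0 T
    · simp [ht]
    · rw [h3]; simp [ht]
  have hLU2 := hL hLU hU' hUi
  have hLP2 := hL hLP hP' hPi
  have hB : ∀ {D D' : ℝ → E →L[ℝ] ℝ} {a b : ℝ → ℝ},
      (∀ᵐ t ∂(volume.restrict (Ioc 0 T)), ∀ v, |D t v| ≤ a t * ‖v‖ + b t * ‖L v‖) →
      D' =ᵐ[volume.restrict (Ioc 0 T)] D → D' = (Ioc 0 T).indicator D' →
      ∀ᵐ t, ∀ v, |D' t v| ≤ (Ioc 0 T).indicator a t * ‖v‖ + (Ioc 0 T).indicator b t * ‖L v‖ := by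
    intro D D' a b h1 h2 h3
    rw [ae_restrict_iff' hs] at h1
    filter_upwards [h1, (ae_restrict_iff' hs).1 h2] with t ht ht' v
    by_cases htm : t ∈ Ioc 0 T
    · simpa [htm, ht' htm] using ht htm v
    · rw [h3]; simp [htm]
  have hGb2 := hB hGb hG' hGi
  have hQb2 := hB hQb hQ' hQi
  have haG2 := (memLp_indicator_iff_restrict hs).2 haG
  have hbG2 := (memLp_indicator_iff_restrict hs).2 hbG
  have haQ2 := (memLp_indicator_iff_restrict hs).2 haQ
  have hbQ2 := (memLp_indicator_iff_restrict hs).2 hbQ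
  have hI : ∀ {D D' : ℝ → E →L[ℝ] ℝ}, D' =ᵐ[volume.restrict (Ioc 0 T)] D →
      ∀ s t, 0 < s → s ≤ t → t < T → ∀ v, ∫ r in s..t, D r v = ∫ r in s..t, D' r v := by
    intro D D' h s t h0 hst htT v
    rw [intervalIntegral.integral_of_le hst, intervalIntegral.integral_of_le hst]
    refine integral_congr_ae ?_
    have hsub : Ioc s t ⊆ Ioc 0 T := Ioc_subset_Ioc h0.le htT.le
    filter_upwards [ae_restrict_of_ae_restrict_of_subset hsub h] with r hr
    rw [hr]
  have key := inner_sub_inner_eq_integral_aux ι hT hu hp hUm hPm hGm hQm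
    ((ae_restrict_iff' hs).1 (by filter_upwards [hU', hUu] with t h1 h2; rw [h1, h2]))
    ((ae_restrict_iff' hs).1 (by filter_upwards [hP', hPp] with t h1 h2; rw [h1, h2]))
    hG2 hQ2
    (integrable_apply_of_bound L hG2.1 haG2 hbG2 hGb2 hP2 hLP2)
    (integrable_apply_of_bound L hQ2.1 haQ2 hbQ2 hQb2 hU2 hLU2)
    (tendsto_lintegral_apply_translate_sub L haG2 hbG2 hGb2 hP2 hLP2)
    (tendsto_lintegral_apply_translate_sub L haQ2 hbQ2 hQb2 hU2 hLU2)
    (fun s t h0 hst htT v => (hGu s t h0 hst htT v).trans (hI hG' s t h0 hst htT v))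
    (fun s t h0 hst htT v => (hQp s t h0 hst htT v).trans (hI hQ' s t h0 hst htT v))
  rw [key, intervalIntegral.integral_of_le hT.le, intervalIntegral.integral_of_le hT.le]
  refine integral_congr_ae ?_
  filter_upwards [hG', hQ', hU', hP'] with t h1 h2 h3 h4
  rw [h1, h2, h3, h4]

end ProductRule

/-! ### Ladyzhenskaya's inequality for smooth fields -/

/-- Each of the two columns of the derivative is bounded by the Frobenius norm of the gradient. -/
theorem norm_fderiv_le_gradField (u : Plane → Plane) (x : Plane) :
    ‖fderiv ℝ u x‖ ≤ 2 * ‖gradField u x‖ := by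
  refine ContinuousLinearMap.opNorm_le_bound _ (by positivity) fun v => ?_
  have hcol : ∀ i, ‖fderiv ℝ u x (EuclideanSpace.single i (1 : ℝ))‖ ≤ ‖gradField u x‖ := by
    intro i
    rw [EuclideanSpace.norm_eq, EuclideanSpace.norm_eq]
    refine Real.sqrt_le_sqrt ?_
    rw [Fintype.sum_prod_type]
    exact Finset.single_le_sum (f := fun i => ∑ j, ‖gradField u x (i, j)‖ ^ 2)
      (fun i _ => Finset.sum_nonneg fun j _ => by positivity) (Finset.mem_univ i)
  have hv : v = ∑ i, v i • EuclideanSpace.single i (1 : ℝ) := by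
    ext j; fin_cases j <;> simp [Fin.sum_univ_two]
  have hvi : ∀ i, |v i| ≤ ‖v‖ := fun i => by simpa using PiLp.norm_apply_le v i
  calc ‖fderiv ℝ u x v‖
      = ‖∑ i, v i • fderiv ℝ u x (EuclideanSpace.single i (1 : ℝ))‖ := by
        conv_lhs => rw [hv]
        simp only [map_sum, map_smul]
    _ ≤ ∑ i, ‖v i • fderiv ℝ u x (EuclideanSpace.single i (1 : ℝ))‖ := norm_sum_le _ _
    _ ≤ ∑ _i : Fin 2, ‖v‖ * ‖gradField u x‖ := by
        refine Finset.sum_le_sum fun i _ => ?_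
        rw [norm_smul, Real.norm_eq_abs]
        exact mul_le_mul (hvi i) (hcol i) (norm_nonneg _) (norm_nonneg _)
    _ = 2 * ‖gradField u x‖ * ‖v‖ := by simp; ring

theorem continuous_gradField {u : Plane → Plane} (hu : ContDiff ℝ ∞ u) :
    Continuous (gradField u) := by
  refine (PiLp.continuous_toLp 2 _).comp (continuous_pi fun ij => ?_)
  have : Continuous fun x => fderiv ℝ u x (EuclideanSpace.single ij.1 (1 : ℝ)) :=
    (hu.continuous_fderiv (by simp)).clm_apply continuous_const
  exact (EuclideanSpace.proj ij.2 : Plane →L[ℝ] ℝ).continuous.comp this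

theorem support_gradField_subset (u : Plane → Plane) :
    Function.support (gradField u) ⊆ tsupport u := by
  intro x hx
  by_contra h
  apply hx
  have h0 : fderiv ℝ u x = 0 := by
    by_contra hne
    exact h (support_fderiv_subset ℝ (Function.mem_support.2 hne))
  ext ij
  simp [gradField, partialD, h0]

theorem hasCompactSupport_gradField {u : Plane → Plane} (hu : HasCompactSupport u) :
    HasCompactSupport (gradField u) :=
  hu.mono' (support_gradField_subset u)

/-- Ladyzhenskaya's inequality in the plane. It is the Gagliardo-Nirenberg-Sobolev inequality
`‖φ‖₂ ≤ C ‖∇φ‖₁` for `φ = |u|²`. -/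
theorem exists_ladyzhenskaya_const : ∃ K : NNReal, ∀ u : Plane → Plane, ContDiff ℝ ∞ u →
    HasCompactSupport u →
    eLpNorm u 4 volume ^ 2 ≤ K * (eLpNorm u 2 volume * eLpNorm (gradField u) 2 volume) := by
  refine ⟨eLpNormLESNormFDerivOneConst (volume : Measure Plane) 2 * 4, fun u hu hc => ?_⟩
  have hφ : ContDiff ℝ 1 (fun x => ‖u x‖ ^ 2) := (hu.of_le (by simp)).norm_sq ℝ
  have hφc : HasCompactSupport (fun x => ‖u x‖ ^ 2) :=
    hc.comp_left (g := fun y : Plane => ‖y‖ ^ 2) (by simp)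
  have hconj : NNReal.HolderConjugate (Module.finrank ℝ Plane) 2 := by
    rw [finrank_euclideanSpace_fin]
    exact NNReal.HolderConjugate.two_two
  have h := eLpNorm_le_eLpNorm_fderiv_one (volume : Measure Plane) hφ hφc hconj
  have h1 : eLpNorm (fun x => ‖u x‖ ^ 2) ((2 : NNReal) : ℝ≥0∞) volume = eLpNorm u 4 volume ^ 2 := by
    have := eLpNorm_norm_rpow (μ := volume) (p := 2) u (q := 2) (by norm_num)
    norm_num at this
    exact_mod_cast this
  have h2 : eLpNorm (fderiv ℝ (fun x => ‖u x‖ ^ 2)) 1 volume ≤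
      4 * (eLpNorm u 2 volume * eLpNorm (gradField u) 2 volume) := by
    have hm := eLpNorm_smul_le_mul_eLpNorm (μ := volume) (p := 2) (q := 2) (r := 1)
      (continuous_gradField hu).aestronglyMeasurable
      (φ := fun x => 4 * ‖u x‖) (hu.continuous.norm.const_mul 4).aestronglyMeasurable
    have hmono : eLpNorm (fderiv ℝ (fun x => ‖u x‖ ^ 2)) 1 volume ≤
        eLpNorm ((fun x => 4 * ‖u x‖) • gradField u) 1 volume := by
      refine eLpNorm_mono fun x => ?_
      have hd : DifferentiableAt ℝ u x := (hu.differentiable (by simp)) x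
      rw [show fderiv ℝ (fun x => ‖u x‖ ^ 2) x = 2 • (innerSL ℝ (u x)).comp (fderiv ℝ u x) from
        hd.hasFDerivAt.norm_sq.fderiv]
      rw [Pi.smul_apply', norm_smul (4 * ‖u x‖), Real.norm_of_nonneg (by positivity)]
      calc ‖2 • (innerSL ℝ (u x)).comp (fderiv ℝ u x)‖
          ≤ 2 * ‖(innerSL ℝ (u x)).comp (fderiv ℝ u x)‖ := by
            simp [two_nsmul, two_mul, norm_add_le]
        _ ≤ 2 * (‖u x‖ * (2 * ‖gradField u x‖)) := by
            gcongr
            refine (ContinuousLinearMap.opNorm_comp_le _ _).trans ?_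
            rw [innerSL_apply_norm]
            gcongr
            exact norm_fderiv_le_gradField u x
        _ = 4 * ‖u x‖ * ‖gradField u x‖ := by ring
    refine hmono.trans (hm.trans (le_of_eq ?_))
    have : eLpNorm (fun x => 4 * ‖u x‖) 2 volume = 4 * eLpNorm u 2 volume := by
      rw [← eLpNorm_norm u, show (fun x => 4 * ‖u x‖) = (4 : ℝ) • fun x => ‖u x‖ from rfl,
        eLpNorm_const_smul]
      congr 1
      rw [Real.enorm_eq_ofReal (by norm_num)]; norm_num
    rw [this, mul_assoc]
  rw [← h1]
  refine h.trans ?_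
  rw [ENNReal.coe_mul, mul_assoc]
  exact mul_le_mul_right h2 _

/-! ### The embedding of `𝕍` into `L⁴` -/

/-- The embedding `𝕍 → L²(O; ℝ²)` as a continuous linear map. -/
def V.valL (O : Set Plane) : V O →L[ℝ] L2Vec O :=
  (WithLp.fstL 2 ℝ (L2Vec O) (L2Grad O)).comp (VSub O).subtypeL

/-- The gradient as a continuous linear map. -/
def V.gradL (O : Set Plane) : V O →L[ℝ] L2Grad O :=
  (WithLp.sndL 2 ℝ (L2Vec O) (L2Grad O)).comp (VSub O).subtypeL

/-- The embedding `𝕍 ⊂ ℍ` as a continuous linear map. -/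
def V.toHL (O : Set Plane) : V O →L[ℝ] H O :=
  (V.valL O).codRestrict (H O) V.val_mem

theorem V.norm_sq (v : V O) : ‖v‖ ^ 2 = ‖V.val v‖ ^ 2 + ‖V.grad v‖ ^ 2 :=
  WithLp.prod_norm_sq_eq_of_L2 v.pair

theorem V.norm_val_le (v : V O) : ‖V.val v‖ ≤ ‖v‖ :=
  le_of_sq_le_sq (by rw [V.norm_sq v]; linarith [sq_nonneg ‖V.grad v‖]) (norm_nonneg _)

theorem V.norm_grad_le (v : V O) : ‖V.grad v‖ ≤ ‖v‖ :=
  le_of_sq_le_sq (by rw [V.norm_sq v]; linarith [sq_nonneg ‖V.val v‖]) (norm_nonneg _)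

theorem V.norm_toH (v : V O) : ‖V.toH v‖ = ‖V.val v‖ := rfl

theorem V.exists_seq_test (v : V O) : ∃ w : ℕ → WithLp 2 (L2Vec O × L2Grad O),
    (∀ n, w n ∈ testH1 O) ∧ Tendsto w atTop (𝓝 v.pair) := by
  have hv : v.pair ∈ closure (testH1 O : Set (WithLp 2 (L2Vec O × L2Grad O))) :=
    Subtype.property (p := (· ∈ VSub O)) v
  exact mem_closure_iff_seq_limit.1 hv

/-- Ladyzhenskaya's inequality on `𝕍`. -/
theorem V.exists_eLpNorm_four_le (O : Set Plane) : ∃ K : NNReal, ∀ v : V O,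
    eLpNorm (V.val v) 4 (volume.restrict O) ^ 2 ≤ K * (‖V.val v‖ₑ * ‖V.grad v‖ₑ) := by
  obtain ⟨K, hK⟩ := exists_ladyzhenskaya_const
  refine ⟨K, fun v => ?_⟩
  obtain ⟨w, hw, hlim⟩ := V.exists_seq_test v
  have hfst : Tendsto (fun n => (w n).fst) atTop (𝓝 (V.val v)) :=
    ((WithLp.fstL 2 ℝ (L2Vec O) (L2Grad O)).continuous.tendsto _).comp hlim
  have hsnd : Tendsto (fun n => (w n).snd) atTop (𝓝 (V.grad v)) :=
    ((WithLp.sndL 2 ℝ (L2Vec O) (L2Grad O)).continuous.tendsto _).comp hlim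
  have hbound : ∀ n, eLpNorm (w n).fst 4 (volume.restrict O) ≤
      (K * (‖(w n).fst‖ₑ * ‖(w n).snd‖ₑ)) ^ (1 / 2 : ℝ) := by
    intro n
    obtain ⟨u, hu, h1, h2⟩ := hw n
    have hs : Function.support u ⊆ O := (subset_tsupport u).trans hu.tsupport_subset
    have hs' : Function.support (gradField u) ⊆ O :=
      (support_gradField_subset u).trans hu.tsupport_subset
    have := hK u hu.contDiff hu.hasCompactSupport
    rw [Lp.enorm_def, Lp.enorm_def, eLpNorm_congr_ae h1, eLpNorm_congr_ae h1,
      eLpNorm_congr_ae h2, eLpNorm_restrict_eq_of_support_subset hs,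
      eLpNorm_restrict_eq_of_support_subset hs, eLpNorm_restrict_eq_of_support_subset hs']
    rw [one_div, ENNReal.le_rpow_inv_iff (by norm_num)]
    exact_mod_cast this
  -- Fatou's lemma along an almost everywhere convergent subsequence of test fields
  obtain ⟨ns, hns, hae⟩ := (tendstoInMeasure_of_tendsto_Lp hfst).exists_seq_tendsto_ae
  have hliminf := Lp.eLpNorm_lim_le_liminf_eLpNorm (p := 4)
    (fun n => Lp.aestronglyMeasurable (w (ns n)).fst) (V.val v) hae
  have hrhs : Tendsto (fun n => (K * (‖(w (ns n)).fst‖ₑ * ‖(w (ns n)).snd‖ₑ)) ^ (1 / 2 : ℝ)) atTop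
      (𝓝 ((K * (‖V.val v‖ₑ * ‖V.grad v‖ₑ)) ^ (1 / 2 : ℝ))) := by
    refine (ENNReal.continuous_rpow_const.tendsto _).comp (ENNReal.Tendsto.const_mul ?_
      (Or.inr ENNReal.coe_ne_top))
    exact ENNReal.Tendsto.mul (hfst.comp hns.tendsto_atTop).enorm (Or.inr enorm_ne_top)
      (hsnd.comp hns.tendsto_atTop).enorm (Or.inr enorm_ne_top)
  have hfin : eLpNorm (V.val v) 4 (volume.restrict O) ≤
      (K * (‖V.val v‖ₑ * ‖V.grad v‖ₑ)) ^ (1 / 2 : ℝ) := by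
    refine hliminf.trans ?_
    rw [← hrhs.liminf_eq]
    exact liminf_le_liminf (Eventually.of_forall fun n => hbound (ns n))
  rw [one_div, ENNReal.le_rpow_inv_iff (by norm_num)] at hfin
  exact_mod_cast hfin

/-- The constant of Ladyzhenskaya's inequality on `𝕍`. -/
def ladyzhenskayaConst (O : Set Plane) : NNReal := (V.exists_eLpNorm_four_le O).choose

theorem V.memLp_four (v : V O) : MemLp (V.val v) 4 (volume.restrict O) := by
  refine ⟨Lp.aestronglyMeasurable _, ?_⟩
  have h := ((V.exists_eLpNorm_four_le O).choose_spec v).trans_lt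
    (ENNReal.mul_lt_top ENNReal.coe_lt_top (ENNReal.mul_lt_top enorm_lt_top enorm_lt_top))
  by_contra hne
  rw [not_lt, top_le_iff] at hne
  rw [hne] at h
  simp at h

/-- `L⁴(O; ℝ²)`. -/
abbrev L4Vec (O : Set Plane) : Type := Lp Plane 4 (volume.restrict O)

theorem V.norm_toLp_four_sq_le (v : V O) : ‖(V.memLp_four v).toLp (V.val v)‖ ^ 2 ≤
    ladyzhenskayaConst O * (‖V.val v‖ * ‖V.grad v‖) := by
  have h := (V.exists_eLpNorm_four_le O).choose_spec v
  have h' := ENNReal.toReal_mono (ENNReal.mul_ne_top ENNReal.coe_ne_top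
    (ENNReal.mul_ne_top enorm_ne_top enorm_ne_top)) h
  rw [Lp.norm_toLp]
  simpa [ENNReal.toReal_mul, ENNReal.toReal_pow, ladyzhenskayaConst] using h'

/-- The embedding `𝕍 ⊂ L⁴(O; ℝ²)`. -/
def V.toL4 (O : Set Plane) : V O →L[ℝ] L4Vec O :=
  LinearMap.mkContinuous
    { toFun := fun v => (V.memLp_four v).toLp (V.val v)
      map_add' := fun v w => by
        rw [← MemLp.toLp_add]
        exact MemLp.toLp_congr _ _ (Lp.coeFn_add (V.val v) (V.val w))
      map_smul' := fun c v => by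
        rw [RingHom.id_apply, ← MemLp.toLp_const_smul]
        exact MemLp.toLp_congr _ _ (Lp.coeFn_smul c (V.val v)) }
    (Real.sqrt (ladyzhenskayaConst O)) fun v => by
      refine le_of_sq_le_sq ?_ (by positivity)
      rw [mul_pow, Real.sq_sqrt NNReal.zero_le_coe]
      refine (V.norm_toLp_four_sq_le v).trans ?_
      rw [sq]
      gcongr
      · exact V.norm_val_le v
      · exact V.norm_grad_le v

theorem V.coeFn_toL4 (v : V O) : V.toL4 O v =ᵐ[volume.restrict O] V.val v :=
  MemLp.coeFn_toLp (V.memLp_four v)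

theorem V.norm_toL4_sq_le (v : V O) :
    ‖V.toL4 O v‖ ^ 2 ≤ ladyzhenskayaConst O * (‖V.toH v‖ * ‖v‖) := by
  refine (V.norm_toLp_four_sq_le v).trans ?_
  gcongr
  · exact le_of_eq (V.norm_toH v).symm
  · exact V.norm_grad_le v

/-! ### The curl and the gradient -/

/-- The null Lagrangian identity: both sides equal `-∫ D²f(v, w) g`. -/
theorem integral_fderiv_mul_fderiv_comm {f g : Plane → ℝ} (hf : ContDiff ℝ ∞ f)
    (hg : ContDiff ℝ ∞ g) (hgc : HasCompactSupport g) (v w : Plane) :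
    ∫ x, fderiv ℝ f x v * fderiv ℝ g x w = ∫ x, fderiv ℝ f x w * fderiv ℝ g x v := by
  have hd : ∀ v, ContDiff ℝ ∞ (fun x => fderiv ℝ f x v) := fun v =>
    (hf.fderiv_right (by simp)).clm_apply contDiff_const
  have hd' : ∀ v, ContDiff ℝ ∞ (fun x => fderiv ℝ g x v) := fun v =>
    (hg.fderiv_right (by simp)).clm_apply contDiff_const
  have hdc : ∀ v, HasCompactSupport (fun x => fderiv ℝ g x v) := fun v =>
    hgc.fderiv_apply ℝ v
  have key : ∀ v w, ∫ x, fderiv ℝ f x v * fderiv ℝ g x w =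
      - ∫ x, fderiv ℝ (fun y => fderiv ℝ f y v) x w * g x := by
    intro v w
    refine integral_mul_fderiv_eq_neg_fderiv_mul_of_integrable ?_ ?_ ?_ ?_ ?_
    · refine Continuous.integrable_of_hasCompactSupport ?_ hgc.mul_left
      exact (((hd v).continuous_fderiv (by simp)).clm_apply continuous_const).mul hg.continuous
    · exact Continuous.integrable_of_hasCompactSupport
        ((hd v).continuous.mul (hd' w).continuous) (hdc w).mul_left
    · exact Continuous.integrable_of_hasCompactSupport
        ((hd v).continuous.mul hg.continuous) hgc.mul_left
    · exact fun x _ => (hd v).differentiable (by simp) x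
    · exact fun x _ => hg.differentiable (by simp) x
  rw [key v w, key w v]
  congr 2
  ext x
  have hsymm : IsSymmSndFDerivAt ℝ f x :=
    (contDiff_infty.1 hf 2).contDiffAt.isSymmSndFDerivAt (by simp)
  have hdf : DifferentiableAt ℝ (fderiv ℝ f) x :=
    (hf.fderiv_right (m := ∞) (by simp)).differentiable (by simp) x
  have h2 : ∀ v w, fderiv ℝ (fun y => fderiv ℝ f y v) x w = fderiv ℝ (fderiv ℝ f) x w v := by
    intro v w
    rw [fderiv_clm_apply hdf (differentiableAt_const v)]
    simp
  rw [h2, h2, hsymm.eq]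

theorem partialD_eq_fderiv_coord {u : Plane → Plane} (hu : ContDiff ℝ ∞ u) (i j : Fin 2)
    (x : Plane) :
    partialD u i j x = fderiv ℝ (fun y => u y j) x (EuclideanSpace.single i (1 : ℝ)) := by
  have h1 : DifferentiableAt ℝ u x := (hu.differentiable (by simp)) x
  have h2 : HasFDerivAt (fun y => u y j)
      ((EuclideanSpace.proj j : Plane →L[ℝ] ℝ).comp (fderiv ℝ u x)) x :=
    (EuclideanSpace.proj j : Plane →L[ℝ] ℝ).hasFDerivAt.comp x h1.hasFDerivAt
  rw [h2.fderiv]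
  rfl

theorem continuous_partialD {u : Plane → Plane} (hu : ContDiff ℝ ∞ u) (i j : Fin 2) :
    Continuous (partialD u i j) :=
  (EuclideanSpace.proj (i, j) : Grad →L[ℝ] ℝ).continuous.comp (continuous_gradField hu)

theorem hasCompactSupport_partialD {u : Plane → Plane} (hu : HasCompactSupport u) (i j : Fin 2) :
    HasCompactSupport (partialD u i j) :=
  (hasCompactSupport_gradField hu).comp_left (g := fun A : Grad => A (i, j)) rfl

theorem IsSolenoidalTest.integral_curl_sq {u : Plane → Plane} (hu : IsSolenoidalTest O u) :
    ∫ x in O, (gradField u x (0, 1) - gradField u x (1, 0)) ^ 2 = ∫ x in O, ‖gradField u x‖ ^ 2 := by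
  have hsupp : ∀ x, x ∉ O → gradField u x = 0 := fun x hx => by
    by_contra hne
    exact hx (hu.tsupport_subset (support_gradField_subset u hne))
  rw [setIntegral_eq_integral_of_forall_compl_eq_zero fun x hx => by rw [hsupp x hx]; simp,
    setIntegral_eq_integral_of_forall_compl_eq_zero fun x hx => by rw [hsupp x hx]; simp]
  have hI : ∀ i j k l, Integrable (fun x => partialD u i j x * partialD u k l x) := fun i j k l =>
    ((continuous_partialD hu.contDiff i j).mul
      (continuous_partialD hu.contDiff k l)).integrable_of_hasCompactSupport
      (hasCompactSupport_partialD hu.hasCompactSupport k l).mul_left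
  have hcoord : ∀ j, ContDiff ℝ ∞ (fun x => u x j) := fun j =>
    (EuclideanSpace.proj j : Plane →L[ℝ] ℝ).contDiff.comp hu.contDiff
  have hnull : ∫ x, partialD u 0 0 x * partialD u 1 1 x =
      ∫ x, partialD u 1 0 x * partialD u 0 1 x := by
    simp only [partialD_eq_fderiv_coord hu.contDiff]
    exact integral_fderiv_mul_fderiv_comm (hcoord 0) (hcoord 1)
      (hu.hasCompactSupport.comp_left (g := fun y : Plane => y 1) rfl) _ _
  -- `div u = 0` turns `(∂₁u₁)² + (∂₂u₂)²` into `-2 ∂₁u₁ ∂₂u₂`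
  have hpt : ∀ x, ‖gradField u x‖ ^ 2 = (gradField u x (0, 1) - gradField u x (1, 0)) ^ 2 +
      2 * (partialD u 1 0 x * partialD u 0 1 x - partialD u 0 0 x * partialD u 1 1 x) := by
    intro x
    have hdiv := hu.div_eq_zero x
    rw [Fin.sum_univ_two] at hdiv
    rw [EuclideanSpace.norm_sq_eq, Fintype.sum_prod_type]
    simp only [Fin.sum_univ_two, gradField, Real.norm_eq_abs, sq_abs]
    have : partialD u 0 0 x = - partialD u 1 1 x := by linarith
    rw [this]
    ring
  have hcurl : Integrable (fun x => (gradField u x (0, 1) - gradField u x (1, 0)) ^ 2) := by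
    have := ((hI 0 1 0 1).sub ((hI 0 1 1 0).const_mul 2)).add (hI 1 0 1 0)
    refine this.congr (Eventually.of_forall fun x => ?_)
    simp [gradField]
    ring
  have hdet : Integrable (fun x => 2 * (partialD u 1 0 x * partialD u 0 1 x -
      partialD u 0 0 x * partialD u 1 1 x)) := ((hI 1 0 0 1).sub (hI 0 0 1 1)).const_mul 2
  simp_rw [hpt]
  rw [integral_add hcurl hdet, integral_const_mul, integral_sub (hI 1 0 0 1) (hI 0 0 1 1), hnull]
  simp

/-- The scalar curl of an array of partial derivatives. -/
def curlForm : Grad →L[ℝ] ℝ :=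
  (EuclideanSpace.proj (0, 1) : Grad →L[ℝ] ℝ) - (EuclideanSpace.proj (1, 0) : Grad →L[ℝ] ℝ)

theorem curlForm_apply (A : Grad) : curlForm A = A (0, 1) - A (1, 0) := rfl

theorem norm_sq_lp_two {F : Type*} [NormedAddCommGroup F] [InnerProductSpace ℝ F]
    (f : Lp F 2 (volume.restrict O)) : ‖f‖ ^ 2 = ∫ x in O, ‖f x‖ ^ 2 := by
  rw [← real_inner_self_eq_norm_sq, L2.inner_def]
  simp

theorem norm_sq_compLp_curlForm (g : L2Grad O) :
    ‖curlForm.compLpL 2 (volume.restrict O) g‖ ^ 2 =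
      ∫ x in O, (g x (0, 1) - g x (1, 0)) ^ 2 := by
  rw [norm_sq_lp_two]
  refine integral_congr_ae ?_
  filter_upwards [curlForm.coeFn_compLpL (p := 2) (μ := volume.restrict O) g] with x hx
  rw [hx, curlForm_apply, Real.norm_eq_abs, sq_abs]

/-- On divergence free fields that vanish on the boundary, the `L²` norms of the curl and of the
gradient agree. -/
theorem curlSq_eq (v : V O) : curlSq v = ‖V.grad v‖ ^ 2 := by
  obtain ⟨w, hw, hlim⟩ := V.exists_seq_test v
  have hsnd : Tendsto (fun n => (w n).snd) atTop (𝓝 (V.grad v)) :=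
    ((WithLp.sndL 2 ℝ (L2Vec O) (L2Grad O)).continuous.tendsto _).comp hlim
  rw [curlSq, ← norm_sq_compLp_curlForm]
  refine tendsto_nhds_unique
    ((((curlForm.compLpL 2 (volume.restrict O)).continuous.tendsto _).comp hsnd).norm.pow 2)
    ((hsnd.norm.pow 2).congr fun n => ?_)
  obtain ⟨u, hu, -, h2⟩ := hw n
  rw [Function.comp_apply, norm_sq_compLp_curlForm, norm_sq_lp_two]
  trans ∫ x in O, ‖gradField u x‖ ^ 2
  · exact integral_congr_ae (by filter_upwards [h2] with x hx; rw [hx])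
  · rw [← hu.integral_curl_sq]
    exact integral_congr_ae (by filter_upwards [h2] with x hx; rw [hx])

/-! ### The nonlinear terms as forms on `L⁴` -/

/-- The tensor product `(a ⊗ b)ᵢⱼ = aᵢ bⱼ`. -/
def tensor : Plane →L[ℝ] Plane →L[ℝ] Grad :=
  LinearMap.mkContinuous₂
    (LinearMap.mk₂ ℝ (fun a b : Plane => (WithLp.toLp 2 fun ij : Fin 2 × Fin 2 => a ij.1 * b ij.2 : Grad))
      (fun a a' b => by ext ij; simp [add_mul]) (fun c a b => by ext ij; simp [mul_assoc])
      (fun a b b' => by ext ij; simp [mul_add]) (fun c a b => by ext ij; simp; ring))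
    1 fun a b => by
      refine le_of_sq_le_sq (le_of_eq ?_) (by positivity)
      rw [one_mul, mul_pow, EuclideanSpace.norm_sq_eq, EuclideanSpace.norm_sq_eq,
        EuclideanSpace.norm_sq_eq, Fintype.sum_prod_type]
      simp [Fin.sum_univ_two, -sq_abs]
      ring

theorem tensor_apply (a b : Plane) (ij : Fin 2 × Fin 2) : tensor a b ij = a ij.1 * b ij.2 := rfl

/-- `a ⊗ b ∈ L²` for `a, b ∈ L⁴`. -/
def tensorL (O : Set Plane) : L4Vec O →L[ℝ] L4Vec O →L[ℝ] L2Grad O :=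
  tensor.holderL (volume.restrict O) 4 4 2

/-- `a · b ∈ L²` for `a, b ∈ L⁴`. -/
def dotL (O : Set Plane) : L4Vec O →L[ℝ] L4Vec O →L[ℝ] Lp ℝ 2 (volume.restrict O) :=
  (innerSL ℝ : Plane →L[ℝ] Plane →L[ℝ] ℝ).holderL (volume.restrict O) 4 4 2

theorem coeFn_tensorL (a b : L4Vec O) :
    tensorL O a b =ᵐ[volume.restrict O] fun x => tensor (a x) (b x) :=
  tensor.coeFn_holder (r := 2) a b

theorem coeFn_dotL (a b : L4Vec O) :
    dotL O a b =ᵐ[volume.restrict O] fun x => inner ℝ (a x) (b x) :=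
  (innerSL ℝ : Plane →L[ℝ] Plane →L[ℝ] ℝ).coeFn_holder (r := 2) a b

theorem dotL_comm (a b : L4Vec O) : dotL O a b = dotL O b a := by
  refine Lp.ext ?_
  filter_upwards [coeFn_dotL a b, coeFn_dotL b a] with x h1 h2
  rw [h1, h2, real_inner_comm]

/-- `∫ (a · b) (c · e)`. -/
def quad (a b c e : L4Vec O) : ℝ := inner ℝ (dotL O a b) (dotL O c e)

theorem quad_eq_integral (a b c e : L4Vec O) :
    quad a b c e = ∫ x in O, inner ℝ (a x) (b x) * inner ℝ (c x) (e x) := by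
  rw [quad, L2.inner_def]
  refine integral_congr_ae ?_
  filter_upwards [coeFn_dotL a b, coeFn_dotL c e] with x h1 h2
  rw [h1, h2]
  simp [mul_comm]

theorem integrable_quad (a b c e : L4Vec O) :
    Integrable (fun x => inner ℝ (a x) (b x) * inner ℝ (c x) (e x)) (volume.restrict O) := by
  refine (L2.integrable_inner (𝕜 := ℝ) (dotL O a b) (dotL O c e)).congr ?_
  filter_upwards [coeFn_dotL a b, coeFn_dotL c e] with x h1 h2
  rw [h1, h2]
  simp [mul_comm]

theorem abs_quad_le (a b c e : L4Vec O) :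
    |quad a b c e| ≤ ‖dotL O‖ ^ 2 * (‖a‖ * ‖b‖ * ‖c‖ * ‖e‖) := by
  refine (abs_real_inner_le_norm _ _).trans ?_
  calc ‖dotL O a b‖ * ‖dotL O c e‖
      ≤ (‖dotL O‖ * ‖a‖ * ‖b‖) * (‖dotL O‖ * ‖c‖ * ‖e‖) :=
        mul_le_mul ((dotL O).le_opNorm₂ a b) ((dotL O).le_opNorm₂ c e) (norm_nonneg _)
          (by positivity)
    _ = _ := by ring

theorem trilinear_eq (u v w : V O) :
    trilinear u v w = inner ℝ (tensorL O (V.toL4 O u) (V.toL4 O w)) (V.grad v) := by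
  rw [trilinear, L2.inner_def]
  refine integral_congr_ae ?_
  filter_upwards [coeFn_tensorL (V.toL4 O u) (V.toL4 O w), V.coeFn_toL4 u, V.coeFn_toL4 w]
    with x h1 h2 h3
  rw [h1, h2, h3, PiLp.inner_apply, Fintype.sum_prod_type]
  simp only [tensor_apply, RCLike.inner_apply, conj_trivial]
  refine Finset.sum_congr rfl fun i _ => Finset.sum_congr rfl fun j _ => ?_
  ring

theorem forch_eq (u v : V O) :
    forch u v = quad (V.toL4 O u) (V.toL4 O u) (V.toL4 O u) (V.toL4 O v) := by
  rw [forch, quad_eq_integral]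
  refine integral_congr_ae ?_
  filter_upwards [V.coeFn_toL4 u, V.coeFn_toL4 v] with x h2 h3
  rw [h2, h3, real_inner_self_eq_norm_sq]

theorem forchDeriv_eq (u w v : V O) :
    forchDeriv u w v = quad (V.toL4 O u) (V.toL4 O u) (V.toL4 O w) (V.toL4 O v) +
      2 * quad (V.toL4 O u) (V.toL4 O w) (V.toL4 O u) (V.toL4 O v) := by
  rw [forchDeriv, quad_eq_integral, quad_eq_integral, ← integral_const_mul,
    ← integral_add (integrable_quad _ _ _ _) ((integrable_quad _ _ _ _).const_mul 2)]
  refine integral_congr_ae ?_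
  filter_upwards [V.coeFn_toL4 u, V.coeFn_toL4 v, V.coeFn_toL4 w] with x h1 h2 h3
  rw [h1, h2, h3, real_inner_self_eq_norm_sq]

theorem forchRemainder_eq (us u p : V O) :
    forchRemainder us u p = 2 * quad (V.toL4 O us) (V.toL4 O u) (V.toL4 O u) (V.toL4 O p) +
      (quad (V.toL4 O u) (V.toL4 O u) (V.toL4 O u) (V.toL4 O p) +
        quad (V.toL4 O u) (V.toL4 O u) (V.toL4 O us) (V.toL4 O p)) := by
  rw [forchRemainder, quad_eq_integral, quad_eq_integral, quad_eq_integral, ← integral_const_mul,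
    ← integral_add (integrable_quad _ _ _ _) (integrable_quad _ _ _ _),
    ← integral_add ((integrable_quad _ _ _ _).const_mul 2)
      ((integrable_quad _ _ _ _).add (integrable_quad _ _ _ _) : Integrable (fun x => _ + _) _)]
  refine integral_congr_ae ?_
  filter_upwards [V.coeFn_toL4 us, V.coeFn_toL4 u, V.coeFn_toL4 p] with x h1 h2 h3
  rw [h1, h2, h3, real_inner_self_eq_norm_sq, inner_add_left, real_inner_smul_left,
    real_inner_smul_left, inner_add_left]
  ring

/-- The quadratic expansion of `b(·, ·, p)` at `us`. -/
theorem trilinear_expand (z us p : V O) :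
    trilinear z z p = trilinear us us p + (trilinear us (z - us) p + trilinear (z - us) us p) +
      trilinear (z - us) (z - us) p := by
  have hg : ∀ v w : V O, V.grad (v - w) = V.grad v - V.grad w := fun v w => rfl
  simp only [trilinear_eq, hg, map_sub, inner_sub_right, inner_sub_left,
    sub_apply]
  ring

/-- The cubic expansion of `⟨𝒞(·), p⟩` at `us`. -/
theorem forch_expand (z us p : V O) :
    forch z p = forch us p + forchDeriv us p (z - us) + forchRemainder us (z - us) p := by
  simp only [forch_eq, forchDeriv_eq, forchRemainder_eq, map_sub]
  set a := V.toL4 O z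
  set b := V.toL4 O us
  set c := V.toL4 O p
  have h1 : dotL O b a = dotL O a b := dotL_comm _ _
  have h2 : dotL O c a = dotL O a c := dotL_comm _ _
  have h3 : dotL O c b = dotL O b c := dotL_comm _ _
  simp only [quad, map_sub, sub_apply, inner_sub_left, inner_sub_right, h1, h2, h3,
    real_inner_comm (dotL O b b) (dotL O b c), real_inner_comm (dotL O a b) (dotL O b c)]
  ring

/-! ### Energy paths and the regularity of their time derivatives -/

namespace EnergyPath

theorem memLp_toH (u : EnergyPath O T) : MemLp u.toH 2 (timeMeasure T) :=
  (memLp_congr_ae u.compat).1 ((V.toHL O).comp_memLp' u.memLp)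

theorem memLp_grad (u : EnergyPath O T) :
    MemLp (fun t => V.grad (u.toV t)) 2 (timeMeasure T) :=
  (V.gradL O).comp_memLp' u.memLp

/-- An energy path lies in `L⁴(0, T; L⁴)`, by Ladyzhenskaya's inequality. -/
theorem memLp_toL4 (u : EnergyPath O T) :
    MemLp (fun t => V.toL4 O (u.toV t)) 4 (timeMeasure T) := by
  have hm : AEStronglyMeasurable (fun t => V.toL4 O (u.toV t)) (timeMeasure T) :=
    (V.toL4 O).continuous.comp_aestronglyMeasurable u.memLp.1
  obtain ⟨M, hM⟩ := isCompact_Icc.exists_bound_of_continuousOn u.continuousOn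
  have h2 : MemLp (fun t => ‖V.toL4 O (u.toV t)‖ ^ 2) 2 (timeMeasure T) := by
    refine (u.memLp.norm.const_mul (ladyzhenskayaConst O * M)).mono (hm.norm.pow 2) ?_
    filter_upwards [u.compat, ae_restrict_mem measurableSet_Ioc] with t ht htm
    have h := V.norm_toL4_sq_le (u.toV t)
    rw [ht] at h
    have hMt := hM t ⟨htm.1.le, htm.2⟩
    rw [Real.norm_of_nonneg (by positivity)]
    refine h.trans (le_trans ?_ (le_abs_self _))
    rw [mul_assoc]
    gcongr
  -- `‖·‖²_{L⁴} ∈ L²(0, T)` is the same as `‖·‖_{L⁴} ∈ L⁴(0, T)`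
  have h4 := memLp_norm_rpow_iff (q := 2) (p := 4) hm (by norm_num) (by norm_num)
  refine h4.1 ?_
  have e : (4 : ℝ≥0∞) / 2 = 2 := by
    rw [show (4 : ℝ≥0∞) = 2 * 2 by norm_num]
    exact ENNReal.mul_div_cancel_right (by norm_num) (by norm_num)
  rw [e]
  simpa using h2

theorem integrable_trilinear (u v w : EnergyPath O T) :
    Integrable (fun t => trilinear (u.toV t) (v.toV t) (w.toV t)) (timeMeasure T) := by
  simp_rw [trilinear_eq]
  exact memLp_one_iff_integrable.1 ((innerSL ℝ : L2Grad O →L[ℝ] L2Grad O →L[ℝ] ℝ).memLp_of_bilin 1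
    ((tensorL O).memLp_of_bilin 2 u.memLp_toL4 w.memLp_toL4) v.memLp_grad)

theorem integrable_quad (a b c e : EnergyPath O T) :
    Integrable (fun t => quad (V.toL4 O (a.toV t)) (V.toL4 O (b.toV t)) (V.toL4 O (c.toV t))
      (V.toL4 O (e.toV t))) (timeMeasure T) :=
  memLp_one_iff_integrable.1
    ((innerSL ℝ : Lp ℝ 2 (volume.restrict O) →L[ℝ] Lp ℝ 2 (volume.restrict O) →L[ℝ] ℝ).memLp_of_bilin
      1 ((dotL O).memLp_of_bilin 2 a.memLp_toL4 b.memLp_toL4)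
      ((dotL O).memLp_of_bilin 2 c.memLp_toL4 e.memLp_toL4))

theorem integrable_forchRemainder (us u p : EnergyPath O T) :
    Integrable (fun t => forchRemainder (us.toV t) (u.toV t) (p.toV t)) (timeMeasure T) := by
  simp_rw [forchRemainder_eq]
  exact ((integrable_quad us u u p).const_mul 2).add
    ((integrable_quad u u u p).add (integrable_quad u u us p))

theorem integrable_stokes (u v : EnergyPath O T) :
    Integrable (fun t => stokes (u.toV t) (v.toV t)) (timeMeasure T) :=
  memLp_one_iff_integrable.1 ((innerSL ℝ : L2Grad O →L[ℝ] L2Grad O →L[ℝ] ℝ).memLp_of_bilin 1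
    u.memLp_grad v.memLp_grad)

/-- Weak continuity at the initial time determines the initial value, since `𝕍` is dense in `ℍ`. -/
theorem toH_zero_eq (hT : 0 < T) (u : EnergyPath O T) {U : H O}
    (h : ∀ v : V O, Tendsto (fun t => (inner ℝ (u.toH t) (V.toH v) : ℝ))
      (𝓝[>] 0) (𝓝 (inner ℝ U (V.toH v)))) : u.toH 0 = U := by
  have hle : 𝓝[>] (0 : ℝ) ≤ 𝓝[Icc 0 T] 0 := by
    rw [← nhdsWithin_Ioo_eq_nhdsGT hT]
    exact nhdsWithin_mono _ Ioo_subset_Icc_self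
  have hu : Tendsto u.toH (𝓝[>] 0) (𝓝 (u.toH 0)) :=
    (u.continuousOn 0 ⟨le_rfl, hT.le⟩).mono_left hle
  have hV : ∀ v : V O, inner ℝ (u.toH 0 - U) (V.toH v) = 0 := by
    intro v
    rw [inner_sub_left, sub_eq_zero]
    exact tendsto_nhds_unique (hu.inner tendsto_const_nhds) (h v)
  have hcl : ∀ w ∈ closure (testL2 O : Set (L2Vec O)),
      inner ℝ ((u.toH 0 - U : H O) : L2Vec O) w = 0 := by
    intro w hw
    refine closure_minimal (t := {w | inner ℝ ((u.toH 0 - U : H O) : L2Vec O) w = 0}) ?_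
      (isClosed_eq (by fun_prop) continuous_const) hw
    rintro f ⟨φ, hφ, hf⟩
    have hg : MemLp (gradField φ) 2 (volume.restrict O) :=
      ((continuous_gradField hφ.contDiff).memLp_of_hasCompactSupport
        (hasCompactSupport_gradField hφ.hasCompactSupport)).restrict O
    -- a test field with its gradient is an element of `𝕍`
    let v : V O := ⟨WithLp.toLp 2 (f, hg.toLp _),
      Submodule.le_topologicalClosure _ ⟨φ, hφ, hf, hg.coeFn_toLp⟩⟩
    exact hV v
  have h0 := hcl _ (u.toH 0 - U).2
  rw [inner_self_eq_zero] at h0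
  exact sub_eq_zero.1 (Subtype.ext h0)

end EnergyPath

theorem IsTimeDerivative.integrable {u : EnergyPath O T} {g : ℝ → VDual O}
    (h : IsTimeDerivative u g) : Integrable g (timeMeasure T) := by
  refine h.1.integrable ?_
  rw [ENNReal.le_div_iff_mul_le (by simp) (by simp)]
  norm_num

theorem IsTimeDerivative.sub_eq_integral (hT : 0 < T) {u : EnergyPath O T} {g : ℝ → VDual O}
    (h : IsTimeDerivative u g) {s t : ℝ} (hs : 0 < s) (hst : s ≤ t) (ht : t < T) (v : V O) :
    inner ℝ (u.toH t) (V.toH v) - inner ℝ (u.toH s) (V.toH v) = ∫ r in s..t, g r v := by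
  refine sub_eq_integral_of_forall_test (u.continuousOn.inner continuousOn_const) ?_
    (fun φ h1 h2 h3 => h.2 φ h1 h2 h3 v) hs hst ht
  rw [intervalIntegrable_iff_integrableOn_Ioc_of_le hT.le]
  have hi : Integrable (fun r => (g r : V O →L[ℝ] ℝ)) (timeMeasure T) := h.integrable
  exact hi.apply_continuousLinearMap v

/-- `g` is the time derivative of `u`, and it is the sum of an element of `L²(0, T; 𝕍')` and of an
element of `L^(4/3)(0, T; L^(4/3))`, in the sense of the bounds for `⟨g(t), v⟩` that this implies. -/
def IsRegularDerivative (u : EnergyPath O T) (g : ℝ → VDual O) : Prop :=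
  IsTimeDerivative u g ∧ ∃ a b : ℝ → ℝ, MemLp a 2 (timeMeasure T) ∧
    MemLp b (4 / 3) (timeMeasure T) ∧
    ∀ᵐ t ∂(timeMeasure T), ∀ v : V O, |g t v| ≤ a t * ‖v‖ + b t * ‖V.toL4 O v‖

theorem IsRegularDerivative.integrable_apply {u : EnergyPath O T} {g : ℝ → VDual O}
    (h : IsRegularDerivative u g) (p : EnergyPath O T) :
    Integrable (fun t => g t (p.toV t)) (timeMeasure T) := by
  obtain ⟨hg, a, b, ha, hb, hab⟩ := h
  have hi : Integrable (fun r => (g r : V O →L[ℝ] ℝ)) (timeMeasure T) := hg.integrable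
  exact integrable_apply_of_bound (V.toL4 O) hi.1 ha hb hab p.memLp p.memLp_toL4

theorem IsRegularDerivative.inner_sub_inner (hT : 0 < T) {u p : EnergyPath O T}
    {g q : ℝ → VDual O} (hu : IsRegularDerivative u g) (hp : IsRegularDerivative p q) :
    inner ℝ (u.toH T) (p.toH T) - inner ℝ (u.toH 0) (p.toH 0) =
      ∫ t in (0 : ℝ)..T, (g t (p.toV t) + q t (u.toV t)) := by
  obtain ⟨hg, a, b, ha, hb, hab⟩ := hu
  obtain ⟨hq, a', b', ha', hb', hab'⟩ := hp
  exact inner_sub_inner_eq_integral (G := fun r => (g r : V O →L[ℝ] ℝ))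
    (Q := fun r => (q r : V O →L[ℝ] ℝ)) (V.toHL O) (V.toL4 O) hT u.continuousOn p.continuousOn
    u.memLp p.memLp u.memLp_toL4 p.memLp_toL4 u.compat p.compat hg.integrable hq.integrable
    ha hb ha' hb' hab hab' (fun s t h1 h2 h3 v => hg.sub_eq_integral hT h1 h2 h3 v)
    (fun s t h1 h2 h3 v => hq.sub_eq_integral hT h1 h2 h3 v)

theorem abs_trilinear_le (u v w : V O) :
    |trilinear u v w| ≤ ‖tensorL O‖ * (‖V.toL4 O u‖ * ‖V.toL4 O w‖ * ‖v‖) := by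
  rw [trilinear_eq]
  refine (abs_real_inner_le_norm _ _).trans ?_
  calc ‖tensorL O (V.toL4 O u) (V.toL4 O w)‖ * ‖V.grad v‖
      ≤ (‖tensorL O‖ * ‖V.toL4 O u‖ * ‖V.toL4 O w‖) * ‖v‖ :=
        mul_le_mul ((tensorL O).le_opNorm₂ _ _) (V.norm_grad_le v) (norm_nonneg _) (by positivity)
    _ = _ := by ring

theorem abs_stokes_le (u v : V O) : |stokes u v| ≤ ‖u‖ * ‖v‖ :=
  (abs_real_inner_le_norm _ _).trans
    (mul_le_mul (V.norm_grad_le u) (V.norm_grad_le v) (norm_nonneg _) (norm_nonneg _))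

theorem abs_inner_toH_le (h : H O) (v : V O) : |(inner ℝ h (V.toH v) : ℝ)| ≤ ‖h‖ * ‖v‖ :=
  (abs_real_inner_le_norm _ _).trans
    (mul_le_mul_of_nonneg_left (V.norm_val_le v) (norm_nonneg _))

theorem abs_forchDeriv_le (u w v : V O) :
    |forchDeriv u w v| ≤ 3 * ‖dotL O‖ ^ 2 * (‖V.toL4 O u‖ * ‖V.toL4 O u‖ * ‖V.toL4 O w‖) *
      ‖V.toL4 O v‖ := by
  rw [forchDeriv_eq]
  have h1 := abs_quad_le (V.toL4 O u) (V.toL4 O u) (V.toL4 O w) (V.toL4 O v)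
  have h2 := abs_quad_le (V.toL4 O u) (V.toL4 O w) (V.toL4 O u) (V.toL4 O v)
  refine (abs_add_le _ _).trans ?_
  rw [abs_mul, abs_two]
  calc _ ≤ _ + 2 * _ := add_le_add h1 (mul_le_mul_of_nonneg_left h2 zero_le_two)
    _ = _ := by ring

theorem VDual.abs_apply_le (g : VDual O) (v : V O) : |g v| ≤ ‖g‖ * ‖v‖ :=
  ContinuousLinearMap.le_opNorm (show V O →L[ℝ] ℝ from g) v

/-- In the state equation `f`, `A u` and `α u` belong to `L²(0, T; 𝕍')`, while `B(u)` and `𝒞(u)` belong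
to `L^(4/3)(0, T; L^(4/3))`. -/
theorem IsWeakSolution.exists_isRegularDerivative {μ α β : ℝ} {f : ℝ → VDual O}
    (hμ : 0 ≤ μ) (hα : 0 ≤ α) (hβ : 0 ≤ β) (hf : MemLp f 2 (timeMeasure T))
    {u : EnergyPath O T} {U : H O} (hu : IsWeakSolution μ α β f u U) :
    ∃ g : ℝ → VDual O, IsRegularDerivative u g ∧
    ∀ᵐ t ∂(timeMeasure T), ∀ v : V O,
      g t v + μ * stokes (u.toV t) v + trilinear (u.toV t) (u.toV t) v +
        α * inner ℝ (u.toH t) (V.toH v) + β * forch (u.toV t) v = f t v := by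
  obtain ⟨g, hg, heq⟩ := hu.equation
  have hN := u.memLp_toL4.norm
  have hNu : MemLp (fun t => ‖V.toL4 O (u.toV t)‖ * ‖u.toV t‖) (4 / 3) (timeMeasure T) :=
    u.memLp.norm.mul (p := 4) (q := 2) (r := 4 / 3) hN
  have hN2 : MemLp (fun t => ‖V.toL4 O (u.toV t)‖ * ‖V.toL4 O (u.toV t)‖) 2 (timeMeasure T) :=
    hN.mul (p := 4) (q := 4) (r := 2) hN
  have hN3 : MemLp (fun t => ‖V.toL4 O (u.toV t)‖ *
      (‖V.toL4 O (u.toV t)‖ * ‖V.toL4 O (u.toV t)‖)) (4 / 3) (timeMeasure T) :=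
    hN2.mul (p := 4) (q := 2) (r := 4 / 3) hN
  refine ⟨g, ⟨hg, fun t => ‖f t‖ + μ * ‖u.toV t‖ + α * ‖u.toH t‖,
    fun t => ‖tensorL O‖ * (‖V.toL4 O (u.toV t)‖ * ‖u.toV t‖) + β * ‖dotL O‖ ^ 2 *
      (‖V.toL4 O (u.toV t)‖ * (‖V.toL4 O (u.toV t)‖ * ‖V.toL4 O (u.toV t)‖)),
    (hf.norm.add (u.memLp.norm.const_mul μ)).add (u.memLp_toH.norm.const_mul α),
    (hNu.const_mul _).add (hN3.const_mul _), ?_⟩, heq⟩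
  filter_upwards [heq] with t ht v
  have e : g t v = f t v - μ * stokes (u.toV t) v - trilinear (u.toV t) (u.toV t) v -
      α * inner ℝ (u.toH t) (V.toH v) - β * forch (u.toV t) v := by
    rw [← ht v]; ring
  have h1 := VDual.abs_apply_le (f t) v
  have h2 := mul_le_mul_of_nonneg_left (abs_stokes_le (u.toV t) v) hμ
  have h3 := abs_trilinear_le (u.toV t) (u.toV t) v
  have h4 := mul_le_mul_of_nonneg_left (abs_inner_toH_le (u.toH t) v) hα
  have h5 := mul_le_mul_of_nonneg_left (abs_quad_le (V.toL4 O (u.toV t)) (V.toL4 O (u.toV t))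
    (V.toL4 O (u.toV t)) (V.toL4 O v)) hβ
  rw [← forch_eq] at h5
  rw [e]
  refine ((abs_sub _ _).trans (add_le_add_left ((abs_sub _ _).trans (add_le_add_left
    ((abs_sub _ _).trans (add_le_add_left (abs_sub _ _) _)) _)) _)).trans ?_
  rw [abs_mul, abs_mul, abs_mul, abs_of_nonneg hμ, abs_of_nonneg hα, abs_of_nonneg hβ]
  linarith

/-- In the adjoint equation `B(u, ·)` contributes to the `L²(0, T; 𝕍')` part, while `B(·, u)` and
`𝒞'(u)` contribute to the `L^(4/3)(0, T; L^(4/3))` part. -/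
theorem IsAdjointSolution.exists_isRegularDerivative {μ α β : ℝ} {uM : ℝ → H O} {uMf : H O}
    (hμ : 0 ≤ μ) (hα : 0 ≤ α) (hβ : 0 ≤ β) (huM : MemLp uM 2 (timeMeasure T))
    {u p : EnergyPath O T} (hp : IsAdjointSolution μ α β uM uMf u p) :
    ∃ g : ℝ → VDual O, IsRegularDerivative p g ∧
    ∀ᵐ t ∂(timeMeasure T), ∀ v : V O,
      - g t v + μ * stokes (p.toV t) v +
        (trilinear (u.toV t) v (p.toV t) + trilinear v (u.toV t) (p.toV t)) +
        α * inner ℝ (p.toH t) (V.toH v) + β * forchDeriv (u.toV t) (p.toV t) v =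
      inner ℝ (u.toH t - uM t) (V.toH v) + stokes (u.toV t) v := by
  obtain ⟨g, hg, heq⟩ := hp.equation
  have hN := u.memLp_toL4.norm
  have hP := p.memLp_toL4.norm
  have hNP : MemLp (fun t => ‖V.toL4 O (u.toV t)‖ * ‖V.toL4 O (p.toV t)‖) 2 (timeMeasure T) :=
    hP.mul (p := 4) (q := 4) (r := 2) hN
  have hPu : MemLp (fun t => ‖V.toL4 O (p.toV t)‖ * ‖u.toV t‖) (4 / 3) (timeMeasure T) :=
    u.memLp.norm.mul (p := 4) (q := 2) (r := 4 / 3) hP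
  have hN3 : MemLp (fun t => ‖V.toL4 O (u.toV t)‖ *
      (‖V.toL4 O (u.toV t)‖ * ‖V.toL4 O (p.toV t)‖)) (4 / 3) (timeMeasure T) :=
    hNP.mul (p := 4) (q := 2) (r := 4 / 3) hN
  refine ⟨g, ⟨hg, fun t => μ * ‖p.toV t‖ + ‖tensorL O‖ *
      (‖V.toL4 O (u.toV t)‖ * ‖V.toL4 O (p.toV t)‖) + α * ‖p.toH t‖ + ‖u.toH t - uM t‖ +
      ‖u.toV t‖,
    fun t => ‖tensorL O‖ * (‖V.toL4 O (p.toV t)‖ * ‖u.toV t‖) + β * (3 * ‖dotL O‖ ^ 2) *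
      (‖V.toL4 O (u.toV t)‖ * (‖V.toL4 O (u.toV t)‖ * ‖V.toL4 O (p.toV t)‖)),
    ((((p.memLp.norm.const_mul μ).add (hNP.const_mul _)).add
      (p.memLp_toH.norm.const_mul α)).add (u.memLp_toH.sub huM).norm).add u.memLp.norm,
    (hPu.const_mul _).add (hN3.const_mul _), ?_⟩, heq⟩
  filter_upwards [heq] with t ht v
  have e : g t v = μ * stokes (p.toV t) v + trilinear (u.toV t) v (p.toV t) +
        trilinear v (u.toV t) (p.toV t) +
        α * inner ℝ (p.toH t) (V.toH v) + β * forchDeriv (u.toV t) (p.toV t) v -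
        inner ℝ (u.toH t - uM t) (V.toH v) - stokes (u.toV t) v := by
    linarith [ht v]
  have h1 := mul_le_mul_of_nonneg_left (abs_stokes_le (p.toV t) v) hμ
  have h2 := abs_trilinear_le (u.toV t) v (p.toV t)
  have h3 := abs_trilinear_le v (u.toV t) (p.toV t)
  have h4 := mul_le_mul_of_nonneg_left (abs_inner_toH_le (p.toH t) v) hα
  have h5 := mul_le_mul_of_nonneg_left (abs_forchDeriv_le (u.toV t) (p.toV t) v) hβ
  have h6 := abs_inner_toH_le (u.toH t - uM t) v
  have h7 := abs_stokes_le (u.toV t) v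
  rw [e]
  refine ((abs_sub _ _).trans (add_le_add_left ((abs_sub _ _).trans (add_le_add_left
    ((abs_add_le _ _).trans (add_le_add_left ((abs_add_le _ _).trans (add_le_add_left
    ((abs_add_le _ _).trans (add_le_add_left (abs_add_le _ _) _)) _)) _)) _)) _)).trans ?_
  rw [abs_mul, abs_mul, abs_mul, abs_of_nonneg hμ, abs_of_nonneg hα, abs_of_nonneg hβ]
  linarith

/-! ### The second order expansion of the cost -/

theorem EnergyPath.sub_toH (u v : EnergyPath O T) (t : ℝ) :
    (u - v).toH t = u.toH t - v.toH t := rfl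

theorem EnergyPath.sub_toV (u v : EnergyPath O T) (t : ℝ) :
    (u - v).toV t = u.toV t - v.toV t := rfl

theorem EnergyPath.integrable_inner_toH (u : EnergyPath O T) {h : ℝ → H O}
    (hh : MemLp h 2 (timeMeasure T)) :
    Integrable (fun t => inner ℝ (h t) (u.toH t)) (timeMeasure T) :=
  memLp_one_iff_integrable.1 ((innerSL ℝ : H O →L[ℝ] H O →L[ℝ] ℝ).memLp_of_bilin 1 hh u.memLp_toH)

theorem integrable_norm_sq {F : Type*} [NormedAddCommGroup F] {h : ℝ → F}
    (hh : MemLp h 2 (timeMeasure T)) :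
    Integrable (fun t => ‖h t‖ ^ 2) (timeMeasure T) :=
  (memLp_two_iff_integrable_sq_norm hh.1).1 hh

/-- The equations for two states, tested with the adjoint state, and the adjoint equation, tested
with the difference `z - us`, give the first variation of the cost up to the second order terms
`∫ ⟨B(d), p⟩` and `β ∫ ⟨2 (us · d) d + |d|² (d + us), p⟩`, where `d = z - us`. -/
theorem integral_firstVariation_eq {μ α β : ℝ} {f : ℝ → VDual O} {uM : ℝ → H O} {uMf : H O}
    (hT : 0 < T) (hμ : 0 ≤ μ) (hα : 0 ≤ α) (hβ : 0 ≤ β) (hf : MemLp f 2 (timeMeasure T))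
    (huM : MemLp uM 2 (timeMeasure T)) {us z p : EnergyPath O T} {Us W : H O}
    (hus : IsWeakSolution μ α β f us Us) (hz : IsWeakSolution μ α β f z W)
    (hp : IsAdjointSolution μ α β uM uMf us p) :
    ∫ t in (0 : ℝ)..T, (inner ℝ (us.toH t - uM t) ((z - us).toH t) +
        stokes (us.toV t) ((z - us).toV t)) =
      inner ℝ ((z - us).toH 0) (p.toH 0) - inner ℝ ((z - us).toH T) (p.toH T) -
        (∫ t in (0 : ℝ)..T, trilinear ((z - us).toV t) ((z - us).toV t) (p.toV t)) -
        β * ∫ t in (0 : ℝ)..T, forchRemainder (us.toV t) ((z - us).toV t) (p.toV t) := by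
  obtain ⟨g, hg, hgeq⟩ := hus.exists_isRegularDerivative hμ hα hβ hf
  obtain ⟨k, hk, hkeq⟩ := hz.exists_isRegularDerivative hμ hα hβ hf
  obtain ⟨q, hq, hqeq⟩ := hp.exists_isRegularDerivative hμ hα hβ huM
  have i1 := hg.inner_sub_inner hT hq
  have i2 := hk.inner_sub_inner hT hq
  have hb : inner ℝ ((z - us).toH T) (p.toH T) - inner ℝ ((z - us).toH 0) (p.toH 0) =
      ∫ t in Ioc 0 T, ((k t (p.toV t) + q t (z.toV t)) - (g t (p.toV t) + q t (us.toV t))) := by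
    rw [integral_sub ((hk.integrable_apply p).fun_add (hq.integrable_apply z))
      ((hg.integrable_apply p).fun_add (hq.integrable_apply us)),
      ← intervalIntegral.integral_of_le hT.le, ← intervalIntegral.integral_of_le hT.le, ← i1, ← i2,
      EnergyPath.sub_toH, EnergyPath.sub_toH, inner_sub_left, inner_sub_left]
    ring
  simp only [intervalIntegral.integral_of_le hT.le]
  have hA : Integrable (fun t => inner ℝ (us.toH t - uM t) ((z - us).toH t) +
      stokes (us.toV t) ((z - us).toV t)) (timeMeasure T) :=
    ((z - us).integrable_inner_toH (us.memLp_toH.sub huM)).add (us.integrable_stokes (z - us))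
  have hB := (z - us).integrable_trilinear (z - us) p
  have hC := (us.integrable_forchRemainder (z - us) p).const_mul β
  have hpt : ∀ᵐ t ∂(timeMeasure T),
      (k t (p.toV t) + q t (z.toV t)) - (g t (p.toV t) + q t (us.toV t)) =
      - ((inner ℝ (us.toH t - uM t) ((z - us).toH t) + stokes (us.toV t) ((z - us).toV t)) +
        (trilinear ((z - us).toV t) ((z - us).toV t) (p.toV t) +
        β * forchRemainder (us.toV t) ((z - us).toV t) (p.toV t))) := by
    filter_upwards [hgeq, hkeq, hqeq, us.compat, z.compat, p.compat, (z - us).compat]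
      with t h1 h2 h3 c1 c2 c3 c4
    have e1 := h1 (p.toV t)
    have e2 := h2 (p.toV t)
    have e3 := h3 ((z - us).toV t)
    have e4 := trilinear_expand (z.toV t) (us.toV t) (p.toV t)
    have e5 := forch_expand (z.toV t) (us.toV t) (p.toV t)
    have e6 : q t ((z - us).toV t) = q t (z.toV t) - q t (us.toV t) := by
      rw [EnergyPath.sub_toV, map_sub]
    have e7 : stokes (p.toV t) ((z - us).toV t) =
        stokes (z.toV t) (p.toV t) - stokes (us.toV t) (p.toV t) := by
      have hgr : V.grad ((z - us).toV t) = V.grad (z.toV t) - V.grad (us.toV t) := rfl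
      rw [stokes, stokes, stokes, hgr, inner_sub_right, real_inner_comm,
        real_inner_comm (V.grad (us.toV t))]
    have e8 : (inner ℝ (p.toH t) ((z - us).toH t) : ℝ) =
        inner ℝ (z.toH t) (p.toH t) - inner ℝ (us.toH t) (p.toH t) := by
      rw [EnergyPath.sub_toH, inner_sub_right, real_inner_comm, real_inner_comm (us.toH t)]
    rw [c3] at e1 e2
    rw [c4, e6, e7, e8] at e3
    rw [← EnergyPath.sub_toV] at e4 e5
    rw [e4, e5] at e2
    linear_combination e2 - e1 - e3
  have htot := hb.trans (integral_congr_ae hpt)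
  rw [integral_neg, integral_add hA (hB.fun_add hC), integral_add hB hC, integral_const_mul] at htot
  linarith

/-- The expansion of the cost at a pair that satisfies the first order condition `U* = -p(0)` has no
first order term, and its remainder is exactly `secondOrderForm`. -/
theorem cost_eq_add_secondOrderForm {μ α β : ℝ} {f : ℝ → VDual O} {uM : ℝ → H O} {uMf : H O}
    (hT : 0 < T) (hμ : 0 ≤ μ) (hα : 0 ≤ α) (hβ : 0 ≤ β) (hf : MemLp f 2 (timeMeasure T))
    (huM : MemLp uM 2 (timeMeasure T)) {us z p : EnergyPath O T} {Us W : H O}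
    (hus : IsWeakSolution μ α β f us Us) (hz : IsWeakSolution μ α β f z W)
    (hp : IsAdjointSolution μ α β uM uMf us p) (hfirst : Us = -p.toH 0) :
    cost uM uMf z W = cost uM uMf us Us + secondOrderForm β us p (z - us) (W - Us) := by
  have hvar := integral_firstVariation_eq hT hμ hα hβ hf huM hus hz hp
  have hz0 : (z - us).toH 0 = W - Us := by
    rw [EnergyPath.sub_toH, z.toH_zero_eq hT hz.initial, us.toH_zero_eq hT hus.initial]
  have hp0 : p.toH 0 = -Us := by rw [hfirst, neg_neg]
  rw [hz0, hp0, hp.terminal] at hvar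
  have hA : Integrable (fun t => inner ℝ (us.toH t - uM t) ((z - us).toH t)) (timeMeasure T) :=
    (z - us).integrable_inner_toH (us.memLp_toH.sub huM)
  have hS := us.integrable_stokes (z - us)
  have hD := integrable_norm_sq (z - us).memLp_toH
  have hG := integrable_norm_sq (z - us).memLp_grad
  have hM : Integrable (fun t => ‖us.toH t - uM t‖ ^ 2) (timeMeasure T) :=
    integrable_norm_sq (us.memLp_toH.sub huM)
  have hU := integrable_norm_sq us.memLp_grad
  have ex1 : ∫ t in Ioc 0 T, ‖z.toH t - uM t‖ ^ 2 = (∫ t in Ioc 0 T, ‖us.toH t - uM t‖ ^ 2) +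
      (2 * (∫ t in Ioc 0 T, inner ℝ (us.toH t - uM t) ((z - us).toH t)) +
      ∫ t in Ioc 0 T, ‖(z - us).toH t‖ ^ 2) := by
    rw [← integral_const_mul, ← integral_add (hA.const_mul 2) hD,
      ← integral_add hM ((hA.const_mul 2).fun_add hD)]
    refine integral_congr_ae (Eventually.of_forall fun t => ?_)
    have : z.toH t - uM t = (us.toH t - uM t) + (z - us).toH t := by
      rw [EnergyPath.sub_toH]; abel
    simp only [this, norm_add_sq_real]
    ring
  have ex2 : ∫ t in Ioc 0 T, curlSq (z.toV t) = (∫ t in Ioc 0 T, curlSq (us.toV t)) +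
      (2 * (∫ t in Ioc 0 T, stokes (us.toV t) ((z - us).toV t)) +
      ∫ t in Ioc 0 T, ‖V.grad ((z - us).toV t)‖ ^ 2) := by
    simp only [curlSq_eq]
    rw [← integral_const_mul, ← integral_add (hS.const_mul 2) hG,
      ← integral_add hU ((hS.const_mul 2).fun_add hG)]
    refine integral_congr_ae (Eventually.of_forall fun t => ?_)
    have : V.grad (z.toV t) = V.grad (us.toV t) + V.grad ((z - us).toV t) :=
      (add_sub_cancel (V.grad (us.toV t)) (V.grad (z.toV t))).symm
    simp only [this, norm_add_sq_real, stokes]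
    ring
  have ex3 : ‖W‖ ^ 2 = ‖Us‖ ^ 2 + 2 * inner ℝ (W - Us) Us + ‖W - Us‖ ^ 2 := by
    conv_lhs => rw [← add_sub_cancel Us W, norm_add_sq_real, real_inner_comm]
  have ex4 : ‖z.toH T - uMf‖ ^ 2 = ‖us.toH T - uMf‖ ^ 2 +
      2 * inner ℝ ((z - us).toH T) (us.toH T - uMf) + ‖(z - us).toH T‖ ^ 2 := by
    have : z.toH T - uMf = (us.toH T - uMf) + (z - us).toH T := by
      rw [EnergyPath.sub_toH]; abel
    rw [this, norm_add_sq_real, real_inner_comm]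
  simp only [intervalIntegral.integral_of_le hT.le] at hvar
  rw [integral_add hA hS, inner_neg_right] at hvar
  simp only [cost, secondOrderForm, intervalIntegral.integral_of_le hT.le]
  rw [ex1, ex2, ex3, ex4, integral_add hD hG]
  linarith

end CBF

end

theorem mainTheorem11
    (O : Set CBF.Plane) (hO : IsOpen O) (hconn : IsConnected O) (hbdd : Bornology.IsBounded O)
    (T μ α β : ℝ) (hT : 0 < T) (hμ : 0 < μ) (hα : 0 ≤ α) (hβ : 0 ≤ β)
    (f : ℝ → CBF.VDual O) (hf : MemLp f 2 (CBF.timeMeasure T))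
    (uM : ℝ → CBF.H O) (huM : MemLp uM 2 (CBF.timeMeasure T)) (uMf : CBF.H O)
    (us : CBF.EnergyPath O T) (Us : CBF.H O)
    (hfeasible : (us, Us) ∈ CBF.admissibleClass T μ α β f)
    (p : CBF.EnergyPath O T) (hp : CBF.IsAdjointSolution μ α β uM uMf us p)
    (hfirst : Us = -p.toH 0)
    (hsecond : ∀ d ∈ CBF.feasibleDifferences T μ α β f us Us,
      0 ≤ CBF.secondOrderForm β us p d.1 d.2) :
    CBF.IsOptimalPair μ α β f uM uMf us Us := by
  refine ⟨hfeasible, fun w hw => ?_⟩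
  have h := hsecond _ ⟨w, hw, rfl⟩
  rw [CBF.cost_eq_add_secondOrderForm hT hμ.le hα hβ hf huM hfeasible.1 hw.1 hp hfirst]
  exact le_add_of_nonneg_right h
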